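/- Let $\Omega\subset\mathbb R^2$ be a convex polygon with $m\ge 3$ sides, given by the array of its vertices in counterclockwise order. For distinct $p,q\in\operatorname{int}\Omega$ let $p',q'$ be the endpoints of the chord of $\Omega$ through $p$ and $q$, in the order $p',p,q,q'$, and let $$H_\Omega(p,q)=\tfrac12\ln\Big(\frac{\|q-p'\|}{\|p-p'\|}\cdot\frac{\|p-q'\|}{\|q-q'\|}\Big),\qquad H_\Omega(p,p)=0,$$ be the Hilbert distance; put $B(c,r)=\{x\in\operatorname{int}\Omega: H_\Omega(c,x)\le r\}$ for $c\in\operatorname{int}\Omega$. A minimum radius enclosing ball of $\{p,q\}$ is a ball $B(c,r)$ that contains $p$ and $q$ and whose radius is $r=\inf\{s: \{p,q\}\subset B(x,s)\text{ for some }x\in\operatorname{int}\Omega\}$. Then, on a real RAM (unit-cost $+,-,\times,/,\sqrt{\ }$ and comparisons of reals, random access to the vertex array), there is an algorithm which, given $\Omega$ and two points $p,q\in\operatorname{int}\Omega$, computes in time $O(\log m)$, with an absolute constant, the lexicographically smallest center of a minimum radius enclosing ball of $\{p,q\}$. Moreover, for $p\ne q$, the set of centers of the minimum radius enclosing balls of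 $\{p,q\}$ is a (possibly degenerate) line segment, namely the part of the bisector $\{c\in\operatorname{int}\Omega: H_\Omega(p,c)=H_\Omega(q,c)\}$ that lies in the sector directly between $p$ and $q$, so that the computed center is the lexicographically smallest point of this segment. Here the sector directly between $p$ and $q$ consists of the points $c\in\operatorname{int}\Omega\setminus\{p,q\}$ such that the rays from $p$ through $q$, from $p$ through $c$ and from $c$ through $q$ leave $\Omega$ through one common closed side, and the rays from $q$ through $p$, from $q$ through $c$ and from $c$ through $p$ leave $\Omega$ through one common closed side. -/

import Mathlib

noncomputable section

/-! ### Polygons and Hilbert geometry in the plane -/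

/-- The Euclidean plane. -/
abbrev Plane : Type := EuclideanSpace ℝ (Fin 2)

/-- Twice the signed area of the triangle `a b c`; positive iff `a, b, c` turn counterclockwise. -/
def orient (a b c : Plane) : ℝ :=
  (b 0 - a 0) * (c 1 - a 1) - (b 1 - a 1) * (c 0 - a 0)

/-- `v 0, …, v (m-1)` are in strictly convex position, listed in counterclockwise order. -/
def IsCCWConvex {m : ℕ} (v : Fin m → Plane) : Prop :=
  ∀ i j k : Fin m, i < j → j < k → 0 < orient (v i) (v j) (v k)

/-- The closed polygonal region with vertices `v`. -/
def polygon {m : ℕ} (v : Fin m → Plane) : Set Plane :=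
  convexHull ℝ (Set.range v)

/-- The closed side of the polygon joining `v i` to its cyclic successor. -/
def side {m : ℕ} (v : Fin m → Plane) (i : Fin m) : Set Plane :=
  segment ℝ (v i) (v (finRotate m i))

/-- The point where the ray from `p` through `q` leaves the convex body `Ω`
(for `p` in the interior of `Ω` and `q ≠ p`). -/
def rayExit (Ω : Set Plane) (p q : Plane) : Plane :=
  p + sSup {t : ℝ | p + t • (q - p) ∈ Ω} • (q - p)

open Classical in
/-- The Hilbert distance on the interior of the convex body `Ω`; the chord through `p` and `q` has
the endpoints `rayExit Ω q p` (on the side of `p`) and `rayExit Ω p q` (on the side of `q`). -/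
def hilbertDist (Ω : Set Plane) (p q : Plane) : ℝ :=
  if p = q then 0
  else (1 / 2) * Real.log
    ((‖q - rayExit Ω q p‖ / ‖p - rayExit Ω q p‖) * (‖p - rayExit Ω p q‖ / ‖q - rayExit Ω p q‖))

/-- The closed Hilbert ball with center `c` and radius `r`. -/
def hilbertBall (Ω : Set Plane) (c : Plane) (r : ℝ) : Set Plane :=
  {x | x ∈ interior Ω ∧ hilbertDist Ω c x ≤ r}

/-- The centers of the minimum radius enclosing Hilbert balls of `S`: the points `c` such that the
ball around `c` whose radius is the infimum of the radii of all balls enclosing `S` encloses `S`. -/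
def minBallCenters (Ω S : Set Plane) : Set Plane :=
  {c | c ∈ interior Ω ∧ ∃ r : ℝ,
    IsGLB {s : ℝ | ∃ x ∈ interior Ω, S ⊆ hilbertBall Ω x s} r ∧ S ⊆ hilbertBall Ω c r}

/-- The lexicographic order on the coordinates. -/
def LexLE (a b : Plane) : Prop :=
  a 0 < b 0 ∨ (a 0 = b 0 ∧ a 1 ≤ b 1)

/-- `c` is the lexicographically smallest point of `S`. -/
def IsLexLeast (S : Set Plane) (c : Plane) : Prop :=
  c ∈ S ∧ ∀ x ∈ S, LexLE c x

/-- The Hilbert bisector of `p` and `q`. -/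
def bisector (Ω : Set Plane) (p q : Plane) : Set Plane :=
  {c | c ∈ interior Ω ∧ hilbertDist Ω p c = hilbertDist Ω q c}

/-- The sector directly between `p` and `q`: the interior points `c`, other than `p` and `q`, such
that the rays from `p` through `q`, from `p` through `c` and from `c` through `q` leave the polygon
through one common (closed) side, and the three opposite rays also do. -/
def sectorBetween {m : ℕ} (v : Fin m → Plane) (p q : Plane) : Set Plane :=
  {c | c ∈ interior (polygon v) ∧ c ≠ p ∧ c ≠ q ∧
    (∃ i : Fin m, rayExit (polygon v) p q ∈ side v i ∧ rayExit (polygon v) p c ∈ side v i ∧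
      rayExit (polygon v) c q ∈ side v i) ∧
    (∃ j : Fin m, rayExit (polygon v) q p ∈ side v j ∧ rayExit (polygon v) q c ∈ side v j ∧
      rayExit (polygon v) c p ∈ side v j)}

/-! ### A real RAM with unit-cost operations

Programs are finite and do not depend on the input. Integers and reals are kept apart: reals admit
`+, -, *, /, √` and comparisons but no rounding, integers admit `+`, truncated subtraction, halving
and comparisons and serve as loop counters and addresses. -/

/-- The machine state: integer registers, real registers, and a random access memory of reals. -/
structure RamState where
  nreg : ℕ → ℕ
  rreg : ℕ → ℝ
  mem : ℕ → ℝ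

/-- Integer expressions. -/
inductive NExpr where
  | const (k : ℕ)
  | reg (i : ℕ)
  | add (a b : NExpr)
  | sub (a b : NExpr)
  | half (a : NExpr)

/-- The value of an integer expression. -/
def NExpr.eval (s : RamState) : NExpr → ℕ
  | .const k => k
  | .reg i => s.nreg i
  | .add a b => a.eval s + b.eval s
  | .sub a b => a.eval s - b.eval s
  | .half a => a.eval s / 2

/-- The number of unit-cost operations (register and constant accesses included). -/
def NExpr.cost : NExpr → ℕ
  | .const _ => 1
  | .reg _ => 1
  | .add a b => a.cost + b.cost + 1
  | .sub a b => a.cost + b.cost + 1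
  | .half a => a.cost + 1

/-- Real expressions; `cell a` reads the memory cell with address `a`. -/
inductive RExpr where
  | const (k : ℚ)
  | reg (i : ℕ)
  | cell (a : NExpr)
  | add (a b : RExpr)
  | sub (a b : RExpr)
  | mul (a b : RExpr)
  | div (a b : RExpr)
  | sqrt (a : RExpr)

open Classical in
/-- The value of a real expression; it is `none` (the machine is stuck) at a division by zero or
the square root of a negative number. -/
def RExpr.eval (s : RamState) : RExpr → Option ℝ
  | .const k => some (k : ℝ)
  | .reg i => some (s.rreg i)
  | .cell a => some (s.mem (a.eval s))
  | .add a b => (a.eval s).bind fun x => (b.eval s).bind fun y => some (x + y)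
  | .sub a b => (a.eval s).bind fun x => (b.eval s).bind fun y => some (x - y)
  | .mul a b => (a.eval s).bind fun x => (b.eval s).bind fun y => some (x * y)
  | .div a b => (a.eval s).bind fun x => (b.eval s).bind fun y =>
      if y = 0 then none else some (x / y)
  | .sqrt a => (a.eval s).bind fun x => if x < 0 then none else some (Real.sqrt x)

/-- The number of unit-cost operations (register, constant and memory accesses included). -/
def RExpr.cost : RExpr → ℕ
  | .const _ => 1
  | .reg _ => 1
  | .cell a => a.cost + 1
  | .add a b => a.cost + b.cost + 1
  | .sub a b => a.cost + b.cost + 1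
  | .mul a b => a.cost + b.cost + 1
  | .div a b => a.cost + b.cost + 1
  | .sqrt a => a.cost + 1

/-- Tests: comparison of two integers or of two reals. -/
inductive RamTest where
  | nle (a b : NExpr)
  | rle (a b : RExpr)
  | rlt (a b : RExpr)

open Classical in
/-- The outcome of a test. -/
def RamTest.eval (s : RamState) : RamTest → Option Bool
  | .nle a b => some (decide (a.eval s ≤ b.eval s))
  | .rle a b => (a.eval s).bind fun x => (b.eval s).bind fun y => some (decide (x ≤ y))
  | .rlt a b => (a.eval s).bind fun x => (b.eval s).bind fun y => some (decide (x < y))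

/-- The cost of a test. -/
def RamTest.cost : RamTest → ℕ
  | .nle a b => a.cost + b.cost + 1
  | .rle a b => a.cost + b.cost + 1
  | .rlt a b => a.cost + b.cost + 1

/-- Programs. -/
inductive RamProg where
  | skip
  | setN (i : ℕ) (e : NExpr)
  | setR (i : ℕ) (e : RExpr)
  | store (a : NExpr) (e : RExpr)
  | seq (P Q : RamProg)
  | ite (b : RamTest) (P Q : RamProg)
  | loop (b : RamTest) (P : RamProg)

/-- `RamExec P s s' t`: started in the state `s`, the program `P` halts in the state `s'` after `t`
steps; `loop b P` runs `P` as long as the test `b` succeeds. -/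
inductive RamExec : RamProg → RamState → RamState → ℕ → Prop where
  | skip (s : RamState) : RamExec .skip s s 1
  | setN (s : RamState) (i : ℕ) (e : NExpr) :
      RamExec (.setN i e) s { s with nreg := Function.update s.nreg i (e.eval s) } (e.cost + 1)
  | setR (s : RamState) (i : ℕ) (e : RExpr) (x : ℝ) (hx : e.eval s = some x) :
      RamExec (.setR i e) s { s with rreg := Function.update s.rreg i x } (e.cost + 1)
  | store (s : RamState) (a : NExpr) (e : RExpr) (x : ℝ) (hx : e.eval s = some x) :
      RamExec (.store a e) s { s with mem := Function.update s.mem (a.eval s) x }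
        (a.cost + e.cost + 1)
  | seq (P Q : RamProg) (s₁ s₂ s₃ : RamState) (t₁ t₂ : ℕ) (h₁ : RamExec P s₁ s₂ t₁)
      (h₂ : RamExec Q s₂ s₃ t₂) : RamExec (.seq P Q) s₁ s₃ (t₁ + t₂)
  | iteTrue (b : RamTest) (P Q : RamProg) (s s' : RamState) (t : ℕ) (hb : b.eval s = some true)
      (h : RamExec P s s' t) : RamExec (.ite b P Q) s s' (b.cost + t)
  | iteFalse (b : RamTest) (P Q : RamProg) (s s' : RamState) (t : ℕ) (hb : b.eval s = some false)
      (h : RamExec Q s s' t) : RamExec (.ite b P Q) s s' (b.cost + t)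
  | loopTrue (b : RamTest) (P : RamProg) (s₁ s₂ s₃ : RamState) (t₁ t₂ : ℕ)
      (hb : b.eval s₁ = some true) (h₁ : RamExec P s₁ s₂ t₁)
      (h₂ : RamExec (.loop b P) s₂ s₃ t₂) : RamExec (.loop b P) s₁ s₃ (b.cost + t₁ + t₂)
  | loopFalse (b : RamTest) (P : RamProg) (s : RamState) (hb : b.eval s = some false) :
      RamExec (.loop b P) s s b.cost

/-- The input: integer register `0` holds `m`, real registers `0, 1, 2, 3` hold the coordinates of
`p` and `q`, the memory cells `2 * i` and `2 * i + 1` hold the coordinates of the vertex `v i`, and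
everything else is `0`. -/
def ramInput {m : ℕ} (v : Fin m → Plane) (p q : Plane) : RamState where
  nreg := fun k => if k = 0 then m else 0
  rreg := fun k =>
    if k = 0 then p 0 else if k = 1 then p 1 else if k = 2 then q 0 else if k = 3 then q 1 else 0
  mem := fun k => if h : k / 2 < m then (if k % 2 = 0 then v ⟨k / 2, h⟩ 0 else v ⟨k / 2, h⟩ 1) else 0

/-- The output: the point whose coordinates are in the real registers `0` and `1`. -/
def ramOutput (s : RamState) : Plane := !₂[s.rreg 0, s.rreg 1]

end

/-! ### Orientation -/

/-! Everything is expressed through the affine side functions f_k = `sideFun v k`, which are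
positive exactly on the interior. For interior a ≠ b the ray from a through b leaves through side i
iff i maximizes f_k(a)/f_k(b); this is `Dominates v i a b`, stated without division. With F_k = log
f_k the Hilbert distance is therefore half the sum of max_k (F_k(a) - F_k(b)) and max_k (F_k(b) -
F_k(a)). The triangle inequality is subadditivity of the maximum, and equality at c means that
maximizing indices for the pair (a, b) also maximize for (a, c) and (c, b), in both directions
(`Dominates.split_of_dist`).

Let p ≠ q, and let i and j be exit sides of the two opposite rays along the line p q. The smallest
radius is half the distance of p and q, attained at a point of the straight segment
(`hilbertMidpoint`), and the centers are the metric midpoints: i dominates for (p, c) and (c, q), j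
dominates for (q, c) and (c, p), and c is equidistant (`IsCenter`). Under these dominance conditions
the distances involve only f_i and f_j, so equidistance becomes the equation sqrt(f_j(p) f_j(q))
f_i(c) = sqrt(f_i(p) f_i(q)) f_j(c), affine in c. The same conditions describe the bisector inside
the sector (`bisector_inter_sectorBetween_eq`). They cut out a compact convex subset of a line,
hence a segment.

For the algorithm, dominance of a fixed side is equivalent to two orientation inequalities at its
ends (`dominates_iff_orient`). An exit side is thus a sign change of orient p q along the vertex
sequence, which bisection finds in logarithmic time once vertices weakly on both sides of the line
are known. After a possible exchange of p and q the first vertex v_0 serves as one; the other comes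
from a preliminary bisection for the side hit by the ray from v_0 through p (`orient_succ_nonneg`).
Given i and j, the centers are the points of a known line satisfying eight linear inequalities, so
the lexicographically smallest one is reached from the midpoint in constant time by the largest
admissible step in the lexicographically decreasing direction (`isLexLeast_of_ratio`). -/

theorem orient_rotate (a b c : Plane) : orient b c a = orient a b c := by
  simp only [orient]; ring

theorem orient_swap_left (a b c : Plane) : orient b a c = -orient a b c := by
  simp only [orient]; ring

theorem orient_swap_right (a b c : Plane) : orient a c b = -orient a b c := by
  simp only [orient]; ring

@[simp] theorem orient_self_left (a b : Plane) : orient a b a = 0 := by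
  simp only [orient]; ring

@[simp] theorem orient_self_right (a b : Plane) : orient a b b = 0 := by
  simp only [orient]; ring

theorem orient_add_smul (a b x d : Plane) (t : ℝ) :
    orient a b (x + t • d) = orient a b x + t * ((b 0 - a 0) * d 1 - (b 1 - a 1) * d 0) := by
  simp [orient]; ring

theorem orient_lineMap (a b x y : Plane) (t : ℝ) :
    orient a b (x + t • (y - x)) = (1 - t) * orient a b x + t * orient a b y := by
  simp [orient]; ring

theorem orient_combo (a b x y : Plane) {s t : ℝ} (h : s + t = 1) :
    orient a b (s • x + t • y) = s * orient a b x + t * orient a b y := by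
  obtain rfl : s = 1 - t := by linarith
  simp [orient]; ring

theorem continuous_orient (a b : Plane) : Continuous (orient a b) := by
  unfold orient; fun_prop

theorem convex_orient_nonneg (a b : Plane) : Convex ℝ {x | 0 ≤ orient a b x} := by
  intro x hx y hy s t hs ht hst
  simp only [Set.mem_ofPred_eq] at *
  rw [orient_combo a b x y hst]
  positivity

theorem plane_ext {x y : Plane} (h0 : x 0 = y 0) (h1 : x 1 = y 1) : x = y := by
  ext i; fin_cases i <;> assumption

/-- A point of a triangle, given by its barycentric coordinates. -/
theorem mem_convexHull_of_orient {s : Set Plane} {a b c x : Plane} (ha : a ∈ s) (hb : b ∈ s)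
    (hc : c ∈ s) (h : 0 < orient a b c) (h1 : 0 ≤ orient b c x) (h2 : 0 ≤ orient c a x)
    (h3 : 0 ≤ orient a b x) : x ∈ convexHull ℝ s := by
  have key : x = (orient b c x / orient a b c) • a + (orient c a x / orient a b c) • b +
      (orient a b x / orient a b c) • c := by
    apply plane_ext <;> simp <;> field_simp <;> simp only [orient] <;> ring
  have hsum : orient b c x / orient a b c + orient c a x / orient a b c +
      orient a b x / orient a b c = 1 := by
    field_simp; simp only [orient]; ring
  rw [key]
  have := (convex_convexHull ℝ s).sum_mem (t := Finset.univ)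
    (w := ![orient b c x / orient a b c, orient c a x / orient a b c, orient a b x / orient a b c])
    (z := ![a, b, c])
    (by intro i _; fin_cases i <;> simp <;> positivity)
    (by simp [Fin.sum_univ_three]; linarith)
    (by intro i _; fin_cases i <;> simp <;> apply subset_convexHull <;> assumption)
  simpa [Fin.sum_univ_three] using this

/-! ### The side functions of a convex polygon -/

/-- Twice the area of the triangle spanned by `x` and the side `k`. -/
noncomputable def sideFun {m : ℕ} (v : Fin m → Plane) (k : Fin m) (x : Plane) : ℝ :=
  orient (v k) (v (finRotate m k)) x

theorem finRotate_cases {m : ℕ} (i : Fin m) :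
    ((finRotate m i : ℕ) = i + 1 ∧ (i : ℕ) + 1 < m) ∨
      ((finRotate m i : ℕ) = 0 ∧ (i : ℕ) + 1 = m) := by
  cases m with
  | zero => exact i.elim0
  | succ n =>
    rw [coe_finRotate]
    have := i.2
    split_ifs with h
    · right; subst h; simp
    · left
      refine ⟨rfl, ?_⟩
      have : (i : ℕ) ≠ n := fun h' => h (Fin.ext (by simpa using h'))
      omega

section Polygon

variable {m : ℕ} {v : Fin m → Plane}

theorem sideFun_lineMap (k : Fin m) (x y : Plane) (t : ℝ) :
    sideFun v k (x + t • (y - x)) = (1 - t) * sideFun v k x + t * sideFun v k y :=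
  orient_lineMap _ _ _ _ _

/-- Convexity is assumed only for increasing indices; a cyclic rotation of the orientation covers
vertices preceding the side and the closing side. -/
theorem sideFun_vertex_pos (hv : IsCCWConvex v) {i k : Fin m} (h1 : k ≠ i)
    (h2 : k ≠ finRotate m i) : 0 < sideFun v i (v k) := by
  have h1' : (k : ℕ) ≠ i := fun h => h1 (Fin.ext h)
  have h2' : (k : ℕ) ≠ (finRotate m i : ℕ) := fun h => h2 (Fin.ext h)
  unfold sideFun
  have := k.2
  rcases finRotate_cases i with ⟨h, h'⟩ | ⟨h, h'⟩
  · rcases lt_or_gt_of_ne h1' with hlt | hgt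
    · rw [orient_rotate]
      exact hv _ _ _ hlt (by rw [Fin.lt_def]; omega)
    · exact hv _ _ _ (by rw [Fin.lt_def]; omega) (by rw [Fin.lt_def]; omega)
  · rw [← orient_rotate]
    exact hv _ _ _ (by rw [Fin.lt_def]; omega) (by rw [Fin.lt_def]; omega)

theorem sideFun_vertex_nonneg (hv : IsCCWConvex v) (i k : Fin m) : 0 ≤ sideFun v i (v k) := by
  by_cases h1 : k = i
  · subst h1; simp [sideFun]
  by_cases h2 : k = finRotate m i
  · subst h2; simp [sideFun]
  exact (sideFun_vertex_pos hv h1 h2).le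

theorem sideFun_nonneg (hv : IsCCWConvex v) (i : Fin m) {x : Plane} (hx : x ∈ polygon v) :
    0 ≤ sideFun v i x := by
  have : convexHull ℝ (Set.range v) ⊆ {x | 0 ≤ orient (v i) (v (finRotate m i)) x} := by
    refine convexHull_min ?_ (convex_orient_nonneg _ _)
    rintro _ ⟨k, rfl⟩
    exact sideFun_vertex_nonneg hv i k
  exact this hx

theorem exists_sign_change {f : ℕ → ℝ} {a b : ℕ} (hab : a < b) (ha : f a ≤ 0) (hb : 0 ≤ f b) :
    ∃ k, a ≤ k ∧ k < b ∧ f k ≤ 0 ∧ 0 ≤ f (k + 1) := by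
  induction b, hab using Nat.le_induction with
  | base => exact ⟨a, le_rfl, by simp, ha, hb⟩
  | succ n hn ih =>
    rcases le_total 0 (f n) with h | h
    · obtain ⟨k, h1, h2, h3⟩ := ih h
      exact ⟨k, h1, by omega, h3⟩
    · exact ⟨n, by omega, by omega, h, hb⟩

/-- The vertices, with the first one repeated at the end. -/
noncomputable def vertexSeq (v : Fin m → Plane) (k : ℕ) : Plane :=
  if h : k < m then v ⟨k, h⟩ else if h : 0 < m then v ⟨0, h⟩ else 0

theorem vertexSeq_of_lt {k : ℕ} (h : k < m) : vertexSeq v k = v ⟨k, h⟩ := by simp [vertexSeq, h]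

theorem vertexSeq_succ (i : Fin m) : vertexSeq v (i + 1) = v (finRotate m i) := by
  rcases finRotate_cases i with ⟨h, h'⟩ | ⟨h, h'⟩
  · rw [vertexSeq_of_lt h']; congr 1; exact Fin.ext h.symm
  · have : 0 < m := by omega
    simp only [vertexSeq, h', lt_irrefl, dite_false, this, dite_true]
    congr 1; exact Fin.ext h.symm

theorem orient_vertexSeq (i : Fin m) (x : Plane) :
    orient (vertexSeq v i) (vertexSeq v (i + 1)) x = sideFun v i x := by
  rw [vertexSeq_succ, vertexSeq_of_lt i.2]; rfl

theorem mem_polygon_of_sideFun_nonneg (hm : 3 ≤ m) (hv : IsCCWConvex v) {x : Plane}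
    (hx : ∀ i, 0 ≤ sideFun v i x) : x ∈ polygon v := by
  have h0 := hx ⟨0, by omega⟩
  have hl := hx ⟨m - 1, by omega⟩
  rw [← orient_vertexSeq] at h0 hl
  simp only [show m - 1 + 1 = m by omega] at hl
  have hvm : vertexSeq v m = vertexSeq v 0 := by
    simp [vertexSeq, show 0 < m by omega]
  rw [hvm] at hl
  -- Fan triangulation from the first vertex: sides 0 and m - 1 give the signs at the two ends, and
  -- a sign change locates the triangle containing x.
  obtain ⟨k, hk1, hk2, hk3, hk4⟩ := exists_sign_change
    (f := fun k => -orient (vertexSeq v 0) (vertexSeq v k) x) (a := 1) (b := m - 1) (by omega)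
    (by simpa using h0) (by rw [← orient_swap_left]; exact hl)
  have hk := hx ⟨k, by omega⟩
  rw [← orient_vertexSeq] at hk
  have hmem : ∀ k, k < m → vertexSeq v k ∈ Set.range v := fun k h => by
    rw [vertexSeq_of_lt h]; exact ⟨_, rfl⟩
  refine mem_convexHull_of_orient (hmem 0 (by omega)) (hmem k (by omega)) (hmem (k + 1) (by omega))
    ?_ hk ?_ (by simpa using hk3)
  · rw [vertexSeq_of_lt (by omega), vertexSeq_of_lt (show k < m by omega),
      vertexSeq_of_lt (show k + 1 < m by omega)]
    exact hv _ _ _ (by rw [Fin.lt_def]; simp; omega) (by rw [Fin.lt_def]; simp)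
  · rw [orient_swap_left]; exact hk4

/-- The linear part of the sum is the cross product with the sum of the edge vectors, which is zero
for a closed polygon. -/
theorem sum_sideFun (v : Fin m → Plane) (x y : Plane) :
    ∑ k, sideFun v k x = ∑ k, sideFun v k y := by
  rw [← sub_eq_zero, ← Finset.sum_sub_distrib]
  have h0 := Equiv.sum_comp (finRotate m) (fun k => v k 0)
  have h1 := Equiv.sum_comp (finRotate m) (fun k => v k 1)
  have : ∀ k, sideFun v k x - sideFun v k y =
      (v (finRotate m k) 0 - v k 0) * (x 1 - y 1) - (v (finRotate m k) 1 - v k 1) * (x 0 - y 0) := by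
    intro k; simp only [sideFun, orient]; ring
  simp only [this, Finset.sum_sub_distrib, ← Finset.sum_mul, h0, h1]
  ring

theorem exists_third (hm : 3 ≤ m) (i : Fin m) : ∃ k : Fin m, k ≠ i ∧ k ≠ finRotate m i := by
  have : ((Finset.univ : Finset (Fin m)) \ {i, finRotate m i}).Nonempty := by
    rw [← Finset.card_pos]
    have h1 := Finset.le_card_sdiff {i, finRotate m i} (Finset.univ : Finset (Fin m))
    have h2 : ({i, finRotate m i} : Finset (Fin m)).card ≤ 2 := Finset.card_le_two
    simp only [Finset.card_univ, Fintype.card_fin] at h1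
    omega
  obtain ⟨k, hk⟩ := this
  simp only [Finset.mem_sdiff, Finset.mem_univ, true_and, Finset.mem_insert, Finset.mem_singleton,
    not_or] at hk
  exact ⟨k, hk.1, hk.2⟩

/-! ### Interior and sides in terms of the side functions -/

theorem mem_interior_polygon_iff (hm : 3 ≤ m) (hv : IsCCWConvex v) {x : Plane} :
    x ∈ interior (polygon v) ↔ ∀ i, 0 < sideFun v i x := by
  constructor
  · intro hx i
    obtain ⟨k, hk1, hk2⟩ := exists_third hm i
    have hk := sideFun_vertex_pos hv hk1 hk2
    -- If the side function vanished at x, a small step away from a vertex where it is positive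
    -- would stay in the polygon and make it negative.
    refine (sideFun_nonneg hv i (interior_subset hx)).lt_of_ne fun h0 => ?_
    have hc : Filter.Tendsto (fun t : ℝ => x + t • (v k - x)) (nhds 0) (nhds x) := by
      have : Continuous (fun t : ℝ => x + t • (v k - x)) := by fun_prop
      simpa using this.tendsto 0
    have hev := hc.eventually (mem_interior_iff_mem_nhds.1 hx)
    obtain ⟨ε, hε, hb⟩ := Metric.eventually_nhds_iff.1 hev
    have := sideFun_nonneg hv i (hb (y := -(ε / 2)) (by
      simp only [dist_zero_right, norm_neg, Real.norm_eq_abs]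
      rw [abs_of_pos (by positivity)]; linarith))
    rw [sideFun_lineMap, ← h0] at this
    nlinarith
  · intro hx
    have ho : IsOpen {x | ∀ i, 0 < sideFun v i x} := by
      simp only [Set.ofPred_forall]
      exact isOpen_iInter_of_finite fun i => isOpen_lt continuous_const (continuous_orient _ _)
    exact interior_maximal (fun y hy => mem_polygon_of_sideFun_nonneg hm hv fun i => (hy i).le) ho hx

theorem finRotate_ne (hm : 3 ≤ m) (i : Fin m) : i ≠ finRotate m i := by
  intro h
  have := congrArg Fin.val h
  rcases finRotate_cases i with ⟨h, h'⟩ | ⟨h, h'⟩ <;> omega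

theorem finRotate_finRotate_ne (hm : 3 ≤ m) (i : Fin m) : i ≠ finRotate m (finRotate m i) := by
  intro h
  have := congrArg Fin.val h
  rcases finRotate_cases i with ⟨h, h'⟩ | ⟨h, h'⟩ <;>
    rcases finRotate_cases (finRotate m i) with ⟨h1, h1'⟩ | ⟨h1, h1'⟩ <;> omega

theorem exists_prev (hm : 3 ≤ m) (hv : IsCCWConvex v) (i : Fin m) :
    ∃ k, sideFun v k (v i) = 0 ∧ 0 < sideFun v k (v (finRotate m i)) := by
  obtain ⟨k, rfl⟩ := (finRotate m).surjective i
  exact ⟨k, by simp [sideFun], sideFun_vertex_pos hv (finRotate_finRotate_ne hm k).symm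
    (finRotate_ne hm _).symm⟩

theorem exists_next (hm : 3 ≤ m) (hv : IsCCWConvex v) (i : Fin m) :
    ∃ k, sideFun v k (v (finRotate m i)) = 0 ∧ 0 < sideFun v k (v i) :=
  ⟨finRotate m i, by simp [sideFun], sideFun_vertex_pos hv (finRotate_ne hm i)
    (finRotate_finRotate_ne hm i)⟩

/-- Vanishing of a side function on the polygon characterizes its side. -/
theorem mem_side_iff (hm : 3 ≤ m) (hv : IsCCWConvex v) {i : Fin m} {x : Plane} :
    x ∈ side v i ↔ x ∈ polygon v ∧ sideFun v i x = 0 := by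
  constructor
  · intro hx
    refine ⟨(convex_convexHull ℝ (Set.range v)).segment_subset
      (subset_convexHull ℝ _ (Set.mem_range_self i))
      (subset_convexHull ℝ _ (Set.mem_range_self (finRotate m i))) hx, ?_⟩
    obtain ⟨a, b, -, -, hab, rfl⟩ := hx
    rw [sideFun, orient_combo _ _ _ _ hab]
    simp
  · rintro ⟨hx, h0⟩
    obtain ⟨w, hw1, hw2⟩ := exists_third hm i
    have hD := sideFun_vertex_pos hv hw1 hw2
    obtain ⟨t, ht⟩ : ∃ t : ℝ, x = v i + t • (v (finRotate m i) - v i) := by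
      -- As a function of x, the numerator is affine, vanishes at `v i` and equals the denominator
      -- at the other end of the side.
      refine ⟨orient (v i) x (v w) / sideFun v i (v w), ?_⟩
      simp only [sideFun, orient] at h0 hD ⊢
      generalize v (finRotate m i) = B at *
      apply plane_ext
      · simp
        rw [div_mul_eq_mul_div, ← sub_eq_iff_eq_add', eq_div_iff hD.ne']
        linear_combination (v w 0 - v i 0) * h0
      · simp
        rw [div_mul_eq_mul_div, ← sub_eq_iff_eq_add', eq_div_iff hD.ne']
        linear_combination (v w 1 - v i 1) * h0
    -- The two adjacent side functions bound the parameter: each vanishes at one end and is positive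
    -- at the other.
    obtain ⟨k, hk0, hk⟩ := exists_prev hm hv i
    obtain ⟨l, hl0, hl⟩ := exists_next hm hv i
    have h1 := sideFun_nonneg hv k hx
    have h2 := sideFun_nonneg hv l hx
    rw [ht, sideFun_lineMap] at h1 h2
    rw [hk0, mul_zero, zero_add] at h1
    rw [hl0, mul_zero, add_zero] at h2
    refine ⟨1 - t, t, nonneg_of_mul_nonneg_left h2 hl, nonneg_of_mul_nonneg_left h1 hk,
      by ring, ?_⟩
    rw [ht]
    module

/-! ### Exit points of rays -/

/-- The ratio of the values at `a` and `b` of the side function of `i` is the largest one. -/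
noncomputable def Dominates (v : Fin m → Plane) (i : Fin m) (a b : Plane) : Prop :=
  ∀ k, sideFun v k a * sideFun v i b ≤ sideFun v i a * sideFun v k b

theorem exists_dominates (hm : 3 ≤ m) (a : Plane) {b : Plane}
    (hb : ∀ i, 0 < sideFun v i b) : ∃ i, Dominates v i a b := by
  have : Nonempty (Fin m) := ⟨⟨0, by omega⟩⟩
  obtain ⟨i, hi⟩ := Finite.exists_max fun k => sideFun v k a / sideFun v k b
  exact ⟨i, fun k => by have := hi k; rwa [div_le_div_iff₀ (hb k) (hb i)] at this⟩

/-- Up to the factor f_i(b) - f_i(c), the left side is f_k at the intersection of the line b c with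
the line of side i, and the right side expands this value in the affine coordinates of that point
with respect to the ends of the side. -/
theorem sideFun_mul_sub (i k : Fin m) (b c : Plane) :
    sideFun v k c * sideFun v i b - sideFun v k b * sideFun v i c =
      orient b c (v (finRotate m i)) * sideFun v k (v i) +
        orient b (v i) c * sideFun v k (v (finRotate m i)) := by
  simp only [sideFun, orient]; ring

theorem dominates_of_orient (hv : IsCCWConvex v) {i : Fin m} {b c : Plane}
    (h1 : 0 ≤ orient b c (v (finRotate m i))) (h2 : 0 ≤ orient b (v i) c) :
    Dominates v i b c := by
  intro k
  have := sideFun_mul_sub i k b c (v := v)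
  have := mul_nonneg h1 (sideFun_vertex_nonneg hv k i)
  have := mul_nonneg h2 (sideFun_vertex_nonneg hv k (finRotate m i))
  linarith

/-- In `sideFun_mul_sub` the values at the vertices are nonnegative, which gives sufficiency. The
side functions of the neighbours of side i each annihilate one of the two terms, which gives
necessity. -/
theorem dominates_iff_orient (hm : 3 ≤ m) (hv : IsCCWConvex v) {i : Fin m} {b c : Plane} :
    Dominates v i b c ↔ 0 ≤ orient b c (v (finRotate m i)) ∧ 0 ≤ orient b (v i) c := by
  refine ⟨fun h => ⟨?_, ?_⟩, fun h => dominates_of_orient hv h.1 h.2⟩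
  · obtain ⟨k, hk0, hk⟩ := exists_next hm hv i
    have h' := sideFun_mul_sub i k b c (v := v)
    rw [hk0] at h'
    have := h k
    by_contra! hneg
    nlinarith
  · obtain ⟨k, hk0, hk⟩ := exists_prev hm hv i
    have h' := sideFun_mul_sub i k b c (v := v)
    rw [hk0] at h'
    have := h k
    by_contra! hneg
    nlinarith

theorem dominates_iff_orient' (hm : 3 ≤ m) (hv : IsCCWConvex v) {i : Fin m} {b c : Plane} :
    Dominates v i c b ↔ orient b c (v (finRotate m i)) ≤ 0 ∧ orient b (v i) c ≤ 0 := by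
  refine ⟨fun h => ⟨?_, ?_⟩, fun h k => ?_⟩
  · obtain ⟨k, hk0, hk⟩ := exists_next hm hv i
    have h' := sideFun_mul_sub i k b c (v := v)
    rw [hk0] at h'
    have := h k
    by_contra! hneg
    nlinarith
  · obtain ⟨k, hk0, hk⟩ := exists_prev hm hv i
    have h' := sideFun_mul_sub i k b c (v := v)
    rw [hk0] at h'
    have := h k
    by_contra! hneg
    nlinarith
  · have := sideFun_mul_sub i k b c (v := v)
    have := mul_nonpos_of_nonpos_of_nonneg h.1 (sideFun_vertex_nonneg hv k i)
    have := mul_nonpos_of_nonpos_of_nonneg h.2 (sideFun_vertex_nonneg hv k (finRotate m i))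
    linarith

/-- Otherwise the largest ratio is at most 1, so no side function is larger at a than at b. Since
their sums agree, all values agree, and two adjacent side functions already determine the point. -/
theorem Dominates.lt {i : Fin m} {a b : Plane} (h : Dominates v i a b) (hm : 3 ≤ m)
    (hv : IsCCWConvex v) (hb : ∀ k, 0 < sideFun v k b) (hab : a ≠ b) :
    sideFun v i b < sideFun v i a := by
  by_contra! hle
  have hall : ∀ k, sideFun v k a ≤ sideFun v k b := by
    intro k
    have := h k
    have h1 : sideFun v i a * sideFun v k b ≤ sideFun v i b * sideFun v k b :=
      mul_le_mul_of_nonneg_right hle (hb k).le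
    exact le_of_mul_le_mul_right (a := sideFun v i b) (by linarith) (hb i)
  have heq := (Finset.sum_eq_sum_iff_of_le fun k (_ : k ∈ Finset.univ) => hall k).1
    (sum_sideFun v a b)
  apply hab
  let i0 : Fin m := ⟨0, by omega⟩
  obtain ⟨w, hw1, hw2⟩ := exists_third hm i0
  have hD := sideFun_vertex_pos hv hw1 hw2
  have e1 := heq i0 (Finset.mem_univ _)
  have e2 := heq (finRotate m i0) (Finset.mem_univ _)
  have hD2 := sideFun_vertex_pos hv (finRotate_ne hm i0) (finRotate_finRotate_ne hm i0)
  simp only [sideFun, orient] at e1 e2 hD2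
  set A := v i0
  set B := v (finRotate m i0)
  set C := v (finRotate m (finRotate m i0))
  apply plane_ext
  · refine mul_left_cancel₀ hD2.ne' ?_
    linear_combination (C 0 - B 0) * e1 - (B 0 - A 0) * e2
  · refine mul_left_cancel₀ hD2.ne' ?_
    linear_combination (C 1 - B 1) * e1 - (B 1 - A 1) * e2

/-- The exit point of a ray is where a dominating side function vanishes. -/
theorem rayExit_eq {i : Fin m} {a b : Plane} (hm : 3 ≤ m) (hv : IsCCWConvex v)
    (h : Dominates v i a b) (hb : ∀ k, 0 < sideFun v k b)
    (hab : a ≠ b) : rayExit (polygon v) a b =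
      a + (sideFun v i a / (sideFun v i a - sideFun v i b)) • (b - a) := by
  have hlt := h.lt hm hv hb hab
  have hpos : 0 < sideFun v i a - sideFun v i b := by linarith
  unfold rayExit
  congr 2
  refine IsGreatest.csSup_eq ⟨?_, ?_⟩
  -- At the parameter where f_i vanishes, nonnegativity of the other side functions is precisely
  -- dominance; for larger parameters f_i is negative.
  · refine mem_polygon_of_sideFun_nonneg hm hv fun k => ?_
    rw [sideFun_lineMap]
    have : (1 - sideFun v i a / (sideFun v i a - sideFun v i b)) * sideFun v k a +
        sideFun v i a / (sideFun v i a - sideFun v i b) * sideFun v k b =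
        (sideFun v i a * sideFun v k b - sideFun v k a * sideFun v i b) /
          (sideFun v i a - sideFun v i b) := by
      field_simp; ring
    rw [this]
    have := h k
    exact div_nonneg (by linarith) hpos.le
  · intro t ht
    have := sideFun_nonneg hv i ht
    rw [sideFun_lineMap] at this
    rw [le_div_iff₀ hpos]
    linarith

theorem sideFun_rayExit {i : Fin m} {a b : Plane} (hm : 3 ≤ m) (hv : IsCCWConvex v)
    (h : Dominates v i a b) (hb : ∀ k, 0 < sideFun v k b)
    (hab : a ≠ b) (k : Fin m) : sideFun v k (rayExit (polygon v) a b) =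
      (sideFun v i a * sideFun v k b - sideFun v k a * sideFun v i b) /
          (sideFun v i a - sideFun v i b) := by
  have hlt := h.lt hm hv hb hab
  have hpos : 0 < sideFun v i a - sideFun v i b := by linarith
  rw [rayExit_eq hm hv h hb hab, sideFun_lineMap]
  field_simp; ring

/-- Sides meeting at an exit vertex correspond to ties in the maximal ratio: f_i vanishes at the
exit point iff i ties with the dominating j. -/
theorem rayExit_mem_side_iff {i : Fin m} {a b : Plane} (hm : 3 ≤ m) (hv : IsCCWConvex v)
    (hb : ∀ k, 0 < sideFun v k b) (hab : a ≠ b) : rayExit (polygon v) a b ∈ side v i ↔ Dominates v i a b := by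
  obtain ⟨j, hj⟩ := exists_dominates hm a hb
  have hlt := hj.lt hm hv hb hab
  have hpos : 0 < sideFun v j a - sideFun v j b := by linarith
  have key := sideFun_rayExit hm hv hj hb hab
  rw [mem_side_iff hm hv, key, div_eq_zero_iff, or_iff_left hpos.ne']
  constructor
  · rintro ⟨-, h⟩ k
    have h1 := hj k
    refine le_of_mul_le_mul_right (a := sideFun v j b) ?_ (hb j)
    calc sideFun v k a * sideFun v i b * sideFun v j b
        = sideFun v k a * sideFun v j b * sideFun v i b := by ring
      _ ≤ sideFun v j a * sideFun v k b * sideFun v i b :=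
          mul_le_mul_of_nonneg_right h1 (hb i).le
      _ = sideFun v i a * sideFun v k b * sideFun v j b := by
          linear_combination sideFun v k b * h
  · intro h
    refine ⟨mem_polygon_of_sideFun_nonneg hm hv fun k => ?_, ?_⟩
    · rw [key]
      have := hj k
      exact div_nonneg (by linarith) hpos.le
    · have h1 := hj i
      have h2 := h j
      linarith

/-! ### The Hilbert distance through the side functions -/

theorem Dominates.norm_ratio {i : Fin m} {a b : Plane} (h : Dominates v i a b) (hm : 3 ≤ m)
    (hv : IsCCWConvex v) (ha : ∀ k, 0 < sideFun v k a) (hb : ∀ k, 0 < sideFun v k b)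
    (hab : a ≠ b) : ‖a - rayExit (polygon v) a b‖ / ‖b - rayExit (polygon v) a b‖ =
      sideFun v i a / sideFun v i b := by
  have hlt := h.lt hm hv hb hab
  have hpos : 0 < sideFun v i a - sideFun v i b := by linarith
  have hn : 0 < ‖b - a‖ := norm_pos_iff.2 (sub_ne_zero.2 hab.symm)
  have e1 : a - rayExit (polygon v) a b =
      (-(sideFun v i a / (sideFun v i a - sideFun v i b))) • (b - a) := by
    rw [rayExit_eq hm hv h hb hab]; module
  have e2 : b - rayExit (polygon v) a b =
      (-(sideFun v i b / (sideFun v i a - sideFun v i b))) • (b - a) := by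
    rw [rayExit_eq hm hv h hb hab,
      show sideFun v i b / (sideFun v i a - sideFun v i b) =
        sideFun v i a / (sideFun v i a - sideFun v i b) - 1 by field_simp; ring]
    module
  have := ha i
  have := hb i
  rw [e1, e2, norm_smul, norm_smul, norm_neg, norm_neg, Real.norm_of_nonneg (by positivity),
    Real.norm_of_nonneg (by positivity)]
  field_simp

theorem hilbertDist_eq {i j : Fin m} {a b : Plane} (hm : 3 ≤ m) (hv : IsCCWConvex v)
    (hi : Dominates v i a b) (hj : Dominates v j b a) (ha : ∀ k, 0 < sideFun v k a)
    (hb : ∀ k, 0 < sideFun v k b) : hilbertDist (polygon v) a b =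
      (1 / 2) * Real.log (sideFun v i a / sideFun v i b * (sideFun v j b / sideFun v j a)) := by
  unfold hilbertDist
  split_ifs with hab
  · subst hab
    rw [div_self (ha i).ne', div_self (ha j).ne']; simp
  · rw [hi.norm_ratio hm hv ha hb hab, hj.norm_ratio hm hv hb ha (Ne.symm hab),
      mul_comm (sideFun v j b / sideFun v j a)]

theorem hilbertDist_comm (Ω : Set Plane) (a b : Plane) : hilbertDist Ω a b = hilbertDist Ω b a := by
  unfold hilbertDist
  by_cases h : a = b
  · simp [h]
  · rw [if_neg h, if_neg (Ne.symm h),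
      mul_comm (‖b - rayExit Ω b a‖ / ‖a - rayExit Ω b a‖)]

end Polygon

/-! ### Geodesics and centers -/

section Centers

variable {m : ℕ} {v : Fin m → Plane}

/-- The logarithm of the side function. -/
noncomputable def sideLog (v : Fin m → Plane) (k : Fin m) (x : Plane) : ℝ := Real.log (sideFun v k x)

/-- In logarithms, the maximal ratio becomes a maximal difference, which is additive along a, c, b;
later metric arguments thereby reduce to linear arithmetic. -/
theorem dominates_iff_sideLog {i : Fin m} {a b : Plane} (ha : ∀ k, 0 < sideFun v k a)
    (hb : ∀ k, 0 < sideFun v k b) :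
    Dominates v i a b ↔ ∀ k, sideLog v k a - sideLog v k b ≤ sideLog v i a - sideLog v i b := by
  refine forall_congr' fun k => ?_
  rw [← Real.log_le_log_iff (mul_pos (ha k) (hb i)) (mul_pos (ha i) (hb k)),
    Real.log_mul (ha k).ne' (hb i).ne', Real.log_mul (ha i).ne' (hb k).ne']
  unfold sideLog
  constructor <;> intro <;> linarith

/-! ### Metric properties of the Hilbert distance -/

theorem hilbertDist_eq_sideLog {i j : Fin m} {a b : Plane} (hm : 3 ≤ m) (hv : IsCCWConvex v)
    (hi : Dominates v i a b) (hj : Dominates v j b a) (ha : ∀ k, 0 < sideFun v k a)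
    (hb : ∀ k, 0 < sideFun v k b) : hilbertDist (polygon v) a b =
      ((sideLog v i a - sideLog v i b) + (sideLog v j b - sideLog v j a)) / 2 := by
  rw [hilbertDist_eq hm hv hi hj ha hb,
    Real.log_mul (div_pos (ha i) (hb i)).ne' (div_pos (hb j) (ha j)).ne',
    Real.log_div (ha i).ne' (hb i).ne', Real.log_div (hb j).ne' (ha j).ne']
  unfold sideLog
  ring

theorem hilbertDist_pos (hm : 3 ≤ m) (hv : IsCCWConvex v) {a b : Plane}
    (ha : ∀ k, 0 < sideFun v k a) (hb : ∀ k, 0 < sideFun v k b) (hab : a ≠ b) :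
    0 < hilbertDist (polygon v) a b := by
  obtain ⟨i, hi⟩ := exists_dominates hm a hb
  obtain ⟨j, hj⟩ := exists_dominates hm b ha
  rw [hilbertDist_eq_sideLog hm hv hi hj ha hb]
  have h1 := Real.log_lt_log (hb i) (hi.lt hm hv hb hab)
  have h2 := Real.log_lt_log (ha j) (hj.lt hm hv ha hab.symm)
  unfold sideLog
  linarith

/-- The indices maximizing for (a, b) are admissible competitors in the maxima for (a, c) and (c,
b). -/
theorem hilbertDist_triangle (hm : 3 ≤ m) (hv : IsCCWConvex v) {a b c : Plane}
    (ha : ∀ k, 0 < sideFun v k a) (hb : ∀ k, 0 < sideFun v k b) (hc : ∀ k, 0 < sideFun v k c) :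
    hilbertDist (polygon v) a b ≤ hilbertDist (polygon v) a c + hilbertDist (polygon v) c b := by
  obtain ⟨i, hi⟩ := exists_dominates hm a hb
  obtain ⟨j, hj⟩ := exists_dominates hm b ha
  obtain ⟨i1, hi1⟩ := exists_dominates hm a hc
  obtain ⟨j1, hj1⟩ := exists_dominates hm c ha
  obtain ⟨i2, hi2⟩ := exists_dominates hm c hb
  obtain ⟨j2, hj2⟩ := exists_dominates hm b hc
  rw [hilbertDist_eq_sideLog hm hv hi hj ha hb, hilbertDist_eq_sideLog hm hv hi1 hj1 ha hc,
    hilbertDist_eq_sideLog hm hv hi2 hj2 hc hb]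
  have e1 := (dominates_iff_sideLog ha hc).1 hi1 i
  have e2 := (dominates_iff_sideLog hc ha).1 hj1 j
  have e3 := (dominates_iff_sideLog hc hb).1 hi2 i
  have e4 := (dominates_iff_sideLog hb hc).1 hj2 j
  linarith

/-- A common maximizer of both summands makes the maximum of the sum equal to the sum of the maxima,
so every maximizer of the sum maximizes both summands. This replaces the unspecified common sides in
the sector by fixed ones. -/
theorem Dominates.split {i i' : Fin m} {a b c : Plane} (h : Dominates v i a b)
    (ha : ∀ k, 0 < sideFun v k a) (hb : ∀ k, 0 < sideFun v k b) (hc : ∀ k, 0 < sideFun v k c)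
    (h1 : Dominates v i' a c) (h2 : Dominates v i' c b) :
    Dominates v i a c ∧ Dominates v i c b := by
  rw [dominates_iff_sideLog ha hb] at h
  rw [dominates_iff_sideLog ha hc] at h1 ⊢
  rw [dominates_iff_sideLog hc hb] at h2 ⊢
  have := h i'
  have e1 := h1 i
  have e2 := h2 i
  constructor <;> intro k <;> have := h1 k <;> have := h2 k <;> linarith

/-- The equality case of the triangle inequality. -/
theorem Dominates.split_of_dist {i j : Fin m} {a b c : Plane} (hm : 3 ≤ m) (hv : IsCCWConvex v)
    (hi : Dominates v i a b) (hj : Dominates v j b a)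
    (ha : ∀ k, 0 < sideFun v k a) (hb : ∀ k, 0 < sideFun v k b) (hc : ∀ k, 0 < sideFun v k c)
    (h : hilbertDist (polygon v) a c + hilbertDist (polygon v) c b ≤ hilbertDist (polygon v) a b) :
    (Dominates v i a c ∧ Dominates v i c b) ∧ (Dominates v j b c ∧ Dominates v j c a) := by
  obtain ⟨i1, hi1⟩ := exists_dominates hm a hc
  obtain ⟨j1, hj1⟩ := exists_dominates hm c ha
  obtain ⟨i2, hi2⟩ := exists_dominates hm c hb
  obtain ⟨j2, hj2⟩ := exists_dominates hm b hc
  rw [hilbertDist_eq_sideLog hm hv hi hj ha hb, hilbertDist_eq_sideLog hm hv hi1 hj1 ha hc,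
    hilbertDist_eq_sideLog hm hv hi2 hj2 hc hb] at h
  rw [dominates_iff_sideLog ha hc] at hi1 ⊢
  rw [dominates_iff_sideLog hc ha] at hj1 ⊢
  rw [dominates_iff_sideLog hc hb] at hi2 ⊢
  rw [dominates_iff_sideLog hb hc] at hj2 ⊢
  have e1 := hi1 i
  have e2 := hj1 j
  have e3 := hi2 i
  have e4 := hj2 j
  refine ⟨⟨fun k => ?_, fun k => ?_⟩, fun k => ?_, fun k => ?_⟩
  · have := hi1 k; linarith
  · have := hi2 k; linarith
  · have := hj2 k; linarith
  · have := hj1 k; linarith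

/-- If f_i(c) were nonpositive, dominance over b would make every f_k(c) nonpositive, contradicting
the constant positive sum. Dominance of (a, c) then carries positivity to all sides. -/
theorem sideFun_pos_of_dominates (hm : 3 ≤ m) {i : Fin m} {a b c : Plane}
    (ha : ∀ k, 0 < sideFun v k a) (hb : ∀ k, 0 < sideFun v k b)
    (h1 : Dominates v i a c) (h2 : Dominates v i c b) (k : Fin m) : 0 < sideFun v k c := by
  have hi : 0 < sideFun v i c := by
    by_contra! hneg
    have hle : ∀ k, sideFun v k c ≤ 0 := fun k => by
      have h1 := h2 k
      have h3 := mul_nonpos_of_nonpos_of_nonneg hneg (hb k).le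
      by_contra! hk
      have := mul_pos hk (hb i)
      linarith
    have h3 := Finset.sum_nonpos fun k (_ : k ∈ Finset.univ) => hle k
    have : (Finset.univ : Finset (Fin m)).Nonempty := ⟨⟨0, by omega⟩, Finset.mem_univ _⟩
    have h4 := Finset.sum_pos (fun k _ => ha k) this
    rw [sum_sideFun v c a] at h3
    linarith
  have h3 := h1 k
  have h4 := mul_pos (ha k) hi
  exact pos_of_mul_pos_right (h4.trans_le h3) (ha i).le

/-- An affine function vanishing on the part of the bisector between `p` and `q`. -/
noncomputable def bisectorFun (v : Fin m → Plane) (i j : Fin m) (p q c : Plane) : ℝ :=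
  Real.sqrt (sideFun v j p * sideFun v j q) * sideFun v i c -
    Real.sqrt (sideFun v i p * sideFun v i q) * sideFun v j c

/-- The logarithmic form is equality of the distances from c to p and to q when i and j are the exit
sides; exponentiating it yields an equation affine in c. -/
theorem bisectorFun_eq_zero_iff {i j : Fin m} {p q c : Plane} (hp : ∀ k, 0 < sideFun v k p)
    (hq : ∀ k, 0 < sideFun v k q) (hc : ∀ k, 0 < sideFun v k c) :
    bisectorFun v i j p q c = 0 ↔
      (sideLog v j p + sideLog v j q) / 2 + sideLog v i c =
        (sideLog v i p + sideLog v i q) / 2 + sideLog v j c := by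
  have hj := mul_pos (hp j) (hq j)
  have hi := mul_pos (hp i) (hq i)
  have hj' := Real.sqrt_pos.2 hj
  have hi' := Real.sqrt_pos.2 hi
  unfold bisectorFun sideLog
  rw [sub_eq_zero, ← Real.log_injOn_pos.eq_iff (mul_pos hj' (hc i)) (mul_pos hi' (hc j)),
    Real.log_mul hj'.ne' (hc i).ne', Real.log_mul hi'.ne' (hc j).ne', Real.log_sqrt hj.le,
    Real.log_sqrt hi.le, Real.log_mul (hp j).ne' (hq j).ne', Real.log_mul (hp i).ne' (hq i).ne']

theorem bisectorFun_lineMap (i j : Fin m) (p q x y : Plane) (t : ℝ) :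
    bisectorFun v i j p q (x + t • (y - x)) =
      (1 - t) * bisectorFun v i j p q x + t * bisectorFun v i j p q y := by
  simp only [bisectorFun, sideFun_lineMap]; ring

/-- By `Dominates.lt`, the geometric mean of f_j(p) and f_j(q) exceeds f_j(p), while that of f_i(p)
and f_i(q) is below f_i(p). -/
theorem bisectorFun_left_pos (hm : 3 ≤ m) (hv : IsCCWConvex v) {i j : Fin m} {p q : Plane}
    (hp : ∀ k, 0 < sideFun v k p) (hq : ∀ k, 0 < sideFun v k q) (hpq : p ≠ q)
    (hi : Dominates v i p q) (hj : Dominates v j q p) : 0 < bisectorFun v i j p q p := by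
  have h1 := hi.lt hm hv hq hpq
  have h2 := hj.lt hm hv hp hpq.symm
  have e1 : Real.sqrt (sideFun v j p * sideFun v j p) * sideFun v i p <
      Real.sqrt (sideFun v j p * sideFun v j q) * sideFun v i p :=
    mul_lt_mul_of_pos_right (Real.sqrt_lt_sqrt (mul_self_nonneg _)
      (mul_lt_mul_of_pos_left h2 (hp j))) (hp i)
  have e2 : Real.sqrt (sideFun v i p * sideFun v i q) * sideFun v j p <
      Real.sqrt (sideFun v i p * sideFun v i p) * sideFun v j p :=
    mul_lt_mul_of_pos_right (Real.sqrt_lt_sqrt (mul_pos (hp i) (hq i)).le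
      (mul_lt_mul_of_pos_left h1 (hp i))) (hp j)
  rw [Real.sqrt_mul_self (hp j).le] at e1
  rw [Real.sqrt_mul_self (hp i).le] at e2
  unfold bisectorFun
  linarith

theorem bisectorFun_swap (i j : Fin m) (p q c : Plane) :
    bisectorFun v i j p q c = -bisectorFun v j i q p c := by
  unfold bisectorFun
  rw [mul_comm (sideFun v j p), mul_comm (sideFun v i p)]; ring

theorem bisectorFun_right_neg (hm : 3 ≤ m) (hv : IsCCWConvex v) {i j : Fin m} {p q : Plane}
    (hp : ∀ k, 0 < sideFun v k p) (hq : ∀ k, 0 < sideFun v k q) (hpq : p ≠ q)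
    (hi : Dominates v i p q) (hj : Dominates v j q p) : bisectorFun v i j p q q < 0 := by
  rw [bisectorFun_swap]
  have := bisectorFun_left_pos hm hv hq hp hpq.symm hj hi
  linarith

/-- The conditions that single out the centers, in terms of fixed sides `i` and `j` through which
the line `p q` leaves the polygon. -/
structure IsCenter (v : Fin m → Plane) (i j : Fin m) (p q c : Plane) : Prop where
  pc : Dominates v i p c
  cq : Dominates v i c q
  qc : Dominates v j q c
  cp : Dominates v j c p
  bis : bisectorFun v i j p q c = 0

theorem IsCenter.pos {i j : Fin m} {p q c : Plane} (h : IsCenter v i j p q c) (hm : 3 ≤ m)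
    (hp : ∀ k, 0 < sideFun v k p) (hq : ∀ k, 0 < sideFun v k q) (k : Fin m) : 0 < sideFun v k c :=
  sideFun_pos_of_dominates hm hp hq h.pc h.cq k

/-- The Hilbert midpoint on the straight segment. -/
noncomputable def hilbertMidpoint (v : Fin m → Plane) (i j : Fin m) (p q : Plane) : Plane :=
  p + (bisectorFun v i j p q p / (bisectorFun v i j p q p - bisectorFun v i j p q q)) • (q - p)

theorem Dominates.lineMap {i : Fin m} {p q : Plane} (h : Dominates v i p q) {t : ℝ} (h0 : 0 ≤ t)
    (h1 : t ≤ 1) : Dominates v i p (p + t • (q - p)) ∧ Dominates v i (p + t • (q - p)) q := by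
  constructor <;> intro k <;> rw [sideFun_lineMap, sideFun_lineMap]
  · have := mul_le_mul_of_nonneg_left (h k) h0
    linarith
  · have := mul_le_mul_of_nonneg_left (h k) (sub_nonneg.2 h1)
    linarith

theorem isCenter_hilbertMidpoint (hm : 3 ≤ m) (hv : IsCCWConvex v) {i j : Fin m} {p q : Plane}
    (hp : ∀ k, 0 < sideFun v k p) (hq : ∀ k, 0 < sideFun v k q) (hpq : p ≠ q)
    (hi : Dominates v i p q) (hj : Dominates v j q p) :
    IsCenter v i j p q (hilbertMidpoint v i j p q) := by
  have h1 := bisectorFun_left_pos hm hv hp hq hpq hi hj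
  have h2 := bisectorFun_right_neg hm hv hp hq hpq hi hj
  unfold hilbertMidpoint
  have hb : bisectorFun v i j p q (p + (bisectorFun v i j p q p /
      (bisectorFun v i j p q p - bisectorFun v i j p q q)) • (q - p)) = 0 := by
    rw [bisectorFun_lineMap]
    have : bisectorFun v i j p q p - bisectorFun v i j p q q ≠ 0 := by linarith
    field_simp
    ring
  set t := bisectorFun v i j p q p / (bisectorFun v i j p q p - bisectorFun v i j p q q) with ht
  have ht0 : 0 ≤ t := div_nonneg h1.le (by linarith)
  have ht1 : t ≤ 1 := (div_le_one (by linarith)).2 (by linarith)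
  obtain ⟨a1, a2⟩ := hi.lineMap ht0 ht1
  obtain ⟨a3, a4⟩ := hj.lineMap (sub_nonneg.2 ht1) (sub_le_self 1 ht0)
  rw [show q + (1 - t) • (p - q) = p + t • (q - p) by module] at a3 a4
  exact ⟨a1, a2, a3, a4, hb⟩

theorem IsCenter.dist {i j : Fin m} {p q c : Plane} (hm : 3 ≤ m) (hv : IsCCWConvex v)
    (hp : ∀ k, 0 < sideFun v k p) (hq : ∀ k, 0 < sideFun v k q)
    (hi : Dominates v i p q) (hj : Dominates v j q p) (h : IsCenter v i j p q c) :
    hilbertDist (polygon v) p c = hilbertDist (polygon v) p q / 2 ∧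
      hilbertDist (polygon v) c q = hilbertDist (polygon v) p q / 2 := by
  have hc := h.pos hm hp hq
  have hb := (bisectorFun_eq_zero_iff hp hq hc).1 h.bis
  rw [hilbertDist_eq_sideLog hm hv hi hj hp hq, hilbertDist_eq_sideLog hm hv h.pc h.cp hp hc,
    hilbertDist_eq_sideLog hm hv h.cq h.qc hc hq]
  constructor <;> linarith

theorem isCenter_of_dist {i j : Fin m} {p q c : Plane} (hm : 3 ≤ m) (hv : IsCCWConvex v)
    (hp : ∀ k, 0 < sideFun v k p) (hq : ∀ k, 0 < sideFun v k q) (hc : ∀ k, 0 < sideFun v k c)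
    (hi : Dominates v i p q) (hj : Dominates v j q p)
    (h1 : hilbertDist (polygon v) p c ≤ hilbertDist (polygon v) p q / 2)
    (h2 : hilbertDist (polygon v) c q ≤ hilbertDist (polygon v) p q / 2) :
    IsCenter v i j p q c := by
  obtain ⟨⟨a1, a2⟩, a3, a4⟩ := hi.split_of_dist hm hv hj hp hq hc (by linarith)
  refine ⟨a1, a2, a3, a4, (bisectorFun_eq_zero_iff hp hq hc).2 ?_⟩
  rw [hilbertDist_eq_sideLog hm hv hi hj hp hq] at h1 h2
  rw [hilbertDist_eq_sideLog hm hv a1 a4 hp hc] at h1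
  rw [hilbertDist_eq_sideLog hm hv a2 a3 hc hq] at h2
  linarith

/-! ### Descriptions of the set of centers -/

theorem minBallCenters_eq {i j : Fin m} {p q : Plane} (hm : 3 ≤ m) (hv : IsCCWConvex v)
    (hp : ∀ k, 0 < sideFun v k p) (hq : ∀ k, 0 < sideFun v k q) (hpq : p ≠ q)
    (hi : Dominates v i p q) (hj : Dominates v j q p) :
    minBallCenters (polygon v) {p, q} = {c | IsCenter v i j p q c} := by
  have hpi := (mem_interior_polygon_iff hm hv).2 hp
  have hqi := (mem_interior_polygon_iff hm hv).2 hq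
  have hsub : ∀ c r, {p, q} ⊆ hilbertBall (polygon v) c r ↔
      hilbertDist (polygon v) p c ≤ r ∧ hilbertDist (polygon v) c q ≤ r := by
    intro c r
    simp [Set.insert_subset_iff, hilbertBall, hpi, hqi, hilbertDist_comm _ c p]
  -- The triangle inequality bounds every enclosing radius from below, and the midpoint on the
  -- segment attains the bound.
  have hmid : IsLeast {s : ℝ | ∃ x ∈ interior (polygon v), {p, q} ⊆ hilbertBall (polygon v) x s}
      (hilbertDist (polygon v) p q / 2) := by
    have hc := isCenter_hilbertMidpoint hm hv hp hq hpq hi hj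
    constructor
    · refine ⟨_, (mem_interior_polygon_iff hm hv).2 (hc.pos hm hp hq), ?_⟩
      have := hc.dist hm hv hp hq hi hj
      rw [hsub]
      exact ⟨this.1.le, this.2.le⟩
    · rintro s ⟨x, hx, hs⟩
      rw [hsub] at hs
      have := hilbertDist_triangle hm hv hp hq ((mem_interior_polygon_iff hm hv).1 hx)
      linarith
  ext c
  constructor
  · rintro ⟨hc, r, hr, h⟩
    rw [hr.unique hmid.isGLB, hsub] at h
    exact isCenter_of_dist hm hv hp hq ((mem_interior_polygon_iff hm hv).1 hc) hi hj h.1 h.2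
  · intro hc
    have := hc.dist hm hv hp hq hi hj
    exact ⟨(mem_interior_polygon_iff hm hv).2 (hc.pos hm hp hq), _, hmid.isGLB,
      (hsub _ _).2 ⟨this.1.le, this.2.le⟩⟩

theorem bisector_inter_sectorBetween_eq {i j : Fin m} {p q : Plane} (hm : 3 ≤ m)
    (hv : IsCCWConvex v) (hp : ∀ k, 0 < sideFun v k p) (hq : ∀ k, 0 < sideFun v k q) (hpq : p ≠ q)
    (hi : Dominates v i p q) (hj : Dominates v j q p) :
    bisector (polygon v) p q ∩ sectorBetween v p q = {c | IsCenter v i j p q c} := by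
  ext c
  constructor
  · rintro ⟨⟨-, hb⟩, hci, hcp, hcq, ⟨i', h1, h2, h3⟩, j', h4, h5, h6⟩
    have hc := (mem_interior_polygon_iff hm hv).1 hci
    rw [rayExit_mem_side_iff hm hv hc hcp.symm] at h2
    rw [rayExit_mem_side_iff hm hv hq hcq] at h3
    rw [rayExit_mem_side_iff hm hv hc hcq.symm] at h5
    rw [rayExit_mem_side_iff hm hv hp hcp] at h6
    obtain ⟨a1, a2⟩ := hi.split hp hq hc h2 h3
    obtain ⟨a3, a4⟩ := hj.split hq hp hc h5 h6
    refine ⟨a1, a2, a3, a4, (bisectorFun_eq_zero_iff hp hq hc).2 ?_⟩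
    rw [hilbertDist_eq_sideLog hm hv a1 a4 hp hc, hilbertDist_eq_sideLog hm hv a3 a2 hq hc] at hb
    linarith
  · intro h
    have hc := h.pos hm hp hq
    have hci := (mem_interior_polygon_iff hm hv).2 hc
    have hpos := hilbertDist_pos hm hv hp hq hpq
    obtain ⟨d1, d2⟩ := h.dist hm hv hp hq hi hj
    have hcp : c ≠ p := by
      rintro rfl
      simp [hilbertDist] at d1
      simp only [hilbertDist] at hpos
      linarith
    have hcq : c ≠ q := by
      rintro rfl
      simp [hilbertDist] at d2
      simp only [hilbertDist] at hpos
      linarith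
    refine ⟨⟨hci, ?_⟩, hci, hcp, hcq, ⟨i, ?_, ?_, ?_⟩, j, ?_, ?_, ?_⟩
    · rw [d1, hilbertDist_comm _ q c, d2]
    · rwa [rayExit_mem_side_iff hm hv hq hpq]
    · rw [rayExit_mem_side_iff hm hv hc hcp.symm]; exact h.pc
    · rw [rayExit_mem_side_iff hm hv hq hcq]; exact h.cq
    · rwa [rayExit_mem_side_iff hm hv hp hpq.symm]
    · rw [rayExit_mem_side_iff hm hv hc hcq.symm]; exact h.qc
    · rw [rayExit_mem_side_iff hm hv hp hcp]; exact h.cp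

theorem minBallCenters_self {p : Plane} (hm : 3 ≤ m) (hv : IsCCWConvex v)
    (hp : ∀ k, 0 < sideFun v k p) : minBallCenters (polygon v) {p, p} = {p} := by
  have hpi := (mem_interior_polygon_iff hm hv).2 hp
  have hself : hilbertDist (polygon v) p p = 0 := by simp [hilbertDist]
  have hmid : IsLeast {s : ℝ | ∃ x ∈ interior (polygon v), {p, p} ⊆ hilbertBall (polygon v) x s}
      0 := by
    constructor
    · exact ⟨p, hpi, by simp [hilbertBall, hpi, hself]⟩
    · rintro s ⟨x, hx, hs⟩
      have := (hs (Set.mem_insert _ _)).2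
      refine le_trans ?_ this
      by_cases h : x = p
      · rw [h, hself]
      · exact (hilbertDist_pos hm hv ((mem_interior_polygon_iff hm hv).1 hx) hp h).le
  ext c
  constructor
  · rintro ⟨hc, r, hr, h⟩
    rw [hr.unique hmid.isGLB] at h
    by_contra hne
    exact (hilbertDist_pos hm hv ((mem_interior_polygon_iff hm hv).1 hc) hp hne).not_ge
      (h (Set.mem_insert _ _)).2
  · rintro rfl
    exact ⟨hpi, 0, hmid.isGLB, by simp [hilbertBall, hpi, hself]⟩

end Centers

/-! ### The segment of centers -/

section Line

variable {m : ℕ} {v : Fin m → Plane}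

theorem exists_smul_of_cross_eq_zero {u w : Plane} (hw : w ≠ 0) (h : w 0 * u 1 - w 1 * u 0 = 0) :
    ∃ s : ℝ, u = s • w := by
  have hn : w 0 * w 0 + w 1 * w 1 ≠ 0 := by
    intro h0
    apply hw
    apply plane_ext <;> simp <;> nlinarith [mul_self_nonneg (w 0), mul_self_nonneg (w 1)]
  refine ⟨(u 0 * w 0 + u 1 * w 1) / (w 0 * w 0 + w 1 * w 1), ?_⟩
  apply plane_ext
  · simp only [PiLp.smul_apply, smul_eq_mul]
    rw [div_mul_eq_mul_div, eq_div_iff hn]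
    linear_combination -(w 1) * h
  · simp only [PiLp.smul_apply, smul_eq_mul]
    rw [div_mul_eq_mul_div, eq_div_iff hn]
    linear_combination w 0 * h

/-- A direction vector of the line on which `bisectorFun` vanishes. -/
noncomputable def bisectorDir (v : Fin m → Plane) (i j : Fin m) (p q : Plane) : Plane :=
  Real.sqrt (sideFun v j p * sideFun v j q) • (v (finRotate m i) - v i) -
    Real.sqrt (sideFun v i p * sideFun v i q) • (v (finRotate m j) - v j)

/-- The linear part of `bisectorFun` is the cross product with `bisectorDir`. Its sign change
between p and q hence shows that this direction is nonzero. -/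
theorem bisectorFun_add (i j : Fin m) (p q x u : Plane) :
    bisectorFun v i j p q (x + u) = bisectorFun v i j p q x +
      (bisectorDir v i j p q 0 * u 1 - bisectorDir v i j p q 1 * u 0) := by
  simp only [bisectorFun, bisectorDir]
  generalize Real.sqrt (sideFun v j p * sideFun v j q) = α
  generalize Real.sqrt (sideFun v i p * sideFun v i q) = β
  simp only [sideFun, orient]
  simp only [PiLp.add_apply, PiLp.sub_apply, PiLp.smul_apply, smul_eq_mul]
  ring

theorem bisectorDir_ne_zero (hm : 3 ≤ m) (hv : IsCCWConvex v) {i j : Fin m} {p q : Plane}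
    (hp : ∀ k, 0 < sideFun v k p) (hq : ∀ k, 0 < sideFun v k q) (hpq : p ≠ q)
    (hi : Dominates v i p q) (hj : Dominates v j q p) : bisectorDir v i j p q ≠ 0 := by
  intro h
  have h1 := bisectorFun_left_pos hm hv hp hq hpq hi hj
  have h2 := bisectorFun_right_neg hm hv hp hq hpq hi hj
  have h3 := bisectorFun_add i j p q p (q - p) (v := v)
  rw [h, add_sub_cancel] at h3
  simp at h3
  linarith

theorem sideFun_combo (k : Fin m) (x y : Plane) {s t : ℝ} (h : s + t = 1) :
    sideFun v k (s • x + t • y) = s * sideFun v k x + t * sideFun v k y :=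
  orient_combo _ _ _ _ h

theorem convex_isCenter (i j : Fin m) (p q : Plane) : Convex ℝ {c | IsCenter v i j p q c} := by
  intro x hx y hy s t hs ht hst
  have hle : ∀ {a b c d : ℝ}, a ≤ b → c ≤ d → s * a + t * c ≤ s * b + t * d := fun h1 h2 =>
    add_le_add (mul_le_mul_of_nonneg_left h1 hs) (mul_le_mul_of_nonneg_left h2 ht)
  refine ⟨fun k => ?_, fun k => ?_, fun k => ?_, fun k => ?_, ?_⟩
  · have := hle (hx.pc k) (hy.pc k); simp only [sideFun_combo _ x y hst]; linarith
  · have := hle (hx.cq k) (hy.cq k); simp only [sideFun_combo _ x y hst]; linarith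
  · have := hle (hx.qc k) (hy.qc k); simp only [sideFun_combo _ x y hst]; linarith
  · have := hle (hx.cp k) (hy.cp k); simp only [sideFun_combo _ x y hst]; linarith
  · have h1 := hx.bis
    have h2 := hy.bis
    unfold bisectorFun at *
    simp only [sideFun_combo _ x y hst]
    linear_combination s * h1 + t * h2

theorem continuous_sideFun (k : Fin m) : Continuous (sideFun v k) := continuous_orient _ _

theorem isClosed_isCenter (i j : Fin m) (p q : Plane) : IsClosed {c | IsCenter v i j p q c} := by
  have : {c | IsCenter v i j p q c} = {c | Dominates v i p c} ∩ {c | Dominates v i c q} ∩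
      {c | Dominates v j q c} ∩ {c | Dominates v j c p} ∩ {c | bisectorFun v i j p q c = 0} := by
    ext c
    exact ⟨fun h => ⟨⟨⟨⟨h.1, h.2⟩, h.3⟩, h.4⟩, h.5⟩, fun h => ⟨h.1.1.1.1, h.1.1.1.2, h.1.1.2, h.1.2, h.2⟩⟩
  rw [this]
  have hs := continuous_sideFun (v := v)
  have h1 : ∀ i a, IsClosed {c | Dominates v i a c} := fun i a => by
    simp only [Dominates, Set.ofPred_forall]
    exact isClosed_iInter fun k => isClosed_le (continuous_const.mul (hs i))
      (continuous_const.mul (hs k))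
  have h2 : ∀ i a, IsClosed {c | Dominates v i c a} := fun i a => by
    simp only [Dominates, Set.ofPred_forall]
    exact isClosed_iInter fun k => isClosed_le ((hs k).mul continuous_const)
      ((hs i).mul continuous_const)
  refine ((((h1 _ _).inter (h2 _ _)).inter (h1 _ _)).inter (h2 _ _)).inter (isClosed_eq ?_
    continuous_const)
  exact (continuous_const.mul (hs i)).sub (continuous_const.mul (hs j))

theorem isBounded_polygon (v : Fin m → Plane) : Bornology.IsBounded (polygon v) :=
  (Set.finite_range v).isCompact_convexHull ℝ |>.isBounded

theorem isBounded_isCenter (hm : 3 ≤ m) (hv : IsCCWConvex v) {i j : Fin m} {p q : Plane}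
    (hp : ∀ k, 0 < sideFun v k p) (hq : ∀ k, 0 < sideFun v k q) {c d : Plane} (hd : d ≠ 0) :
    ∃ R, ∀ s : ℝ, IsCenter v i j p q (c + s • d) → |s| ≤ R := by
  obtain ⟨M, hM⟩ := (isBounded_polygon v).exists_norm_le
  refine ⟨(M + ‖c‖) / ‖d‖, fun s hs => ?_⟩
  have h1 := hM _ (mem_polygon_of_sideFun_nonneg hm hv fun k => (hs.pos hm hp hq k).le)
  rw [le_div_iff₀ (norm_pos_iff.2 hd), ← Real.norm_eq_abs, ← norm_smul]
  calc ‖s • d‖ = ‖(c + s • d) - c‖ := by rw [add_sub_cancel_left]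
    _ ≤ ‖c + s • d‖ + ‖c‖ := norm_sub_le _ _
    _ ≤ M + ‖c‖ := by linarith

theorem IsCenter.exists_smul {i j : Fin m} {p q c x : Plane} (hc : IsCenter v i j p q c)
    (hx : IsCenter v i j p q x) (hd : bisectorDir v i j p q ≠ 0) :
    ∃ s : ℝ, x = c + s • bisectorDir v i j p q := by
  have h := bisectorFun_add i j p q c (x - c) (v := v)
  rw [add_sub_cancel, hx.bis, hc.bis, zero_add] at h
  obtain ⟨s, hs⟩ := exists_smul_of_cross_eq_zero hd h.symm
  exact ⟨s, by rw [← hs, add_sub_cancel]⟩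

theorem exists_isCenter_eq_segment (hm : 3 ≤ m) (hv : IsCCWConvex v) {i j : Fin m} {p q : Plane}
    (hp : ∀ k, 0 < sideFun v k p) (hq : ∀ k, 0 < sideFun v k q) (hpq : p ≠ q)
    (hi : Dominates v i p q) (hj : Dominates v j q p) :
    ∃ a b : Plane, {c | IsCenter v i j p q c} = segment ℝ a b := by
  have hc := isCenter_hilbertMidpoint hm hv hp hq hpq hi hj
  have hd := bisectorDir_ne_zero hm hv hp hq hpq hi hj
  set c := hilbertMidpoint v i j p q
  set d := bisectorDir v i j p q
  obtain ⟨R, hR⟩ := isBounded_isCenter hm hv hp hq (i := i) (j := j) (c := c) hd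
  let f : ℝ →ᵃ[ℝ] Plane := AffineMap.lineMap c (c + d)
  have hf : ∀ s, f s = c + s • d := fun s => by
    simp [f, AffineMap.lineMap_apply, add_comm]
  have hfc : Continuous f := by
    have : (f : ℝ → Plane) = fun s => c + s • d := funext hf
    rw [this]; fun_prop
  set T : Set ℝ := f ⁻¹' {c | IsCenter v i j p q c} with hT
  have hTc : IsCompact T := by
    refine Metric.isCompact_of_isClosed_isBounded ((isClosed_isCenter i j p q).preimage hfc) ?_
    refine (Metric.isBounded_iff_subset_closedBall 0).2 ⟨R, fun s hs => ?_⟩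
    rw [mem_closedBall_zero_iff, Real.norm_eq_abs]
    refine hR s ?_
    rw [← hf]; exact hs
  have hTn : T.Nonempty := ⟨0, by
    change IsCenter v i j p q (f 0)
    rw [hf]; simpa using hc⟩
  have hTx : Convex ℝ T := (convex_isCenter i j p q).affine_preimage f
  -- Pulled back to the parameter line, the set of centers is nonempty, compact and convex, hence a
  -- closed interval.
  have hIcc := eq_Icc_of_connected_compact ⟨hTn, hTx.isPreconnected⟩ hTc
  have hle : sInf T ≤ sSup T := csInf_le_csSup hTn hTc.bddBelow hTc.bddAbove
  refine ⟨f (sInf T), f (sSup T), ?_⟩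
  rw [← image_segment, segment_eq_Icc hle, ← hIcc, hT, Set.image_preimage_eq_of_subset]
  intro x hx
  obtain ⟨s, hs⟩ := hc.exists_smul hx hd
  exact ⟨s, by rw [hf, hs]⟩

/-- The linear constraints on the centers: each pair `(a, b)` stands for `0 ≤ orient a b c`. -/
def centerConstraints {α : Type} (p q v₁ v₂ w₁ w₂ : α) : List (α × α) :=
  [(v₂, p), (p, v₁), (q, v₂), (v₁, q), (w₂, q), (q, w₁), (p, w₂), (w₁, p)]

/-- Each of the four dominance conditions contributes two half-planes, rotated so that c is the last
argument. The number of constraints is thus independent of m. -/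
theorem isCenter_iff (hm : 3 ≤ m) (hv : IsCCWConvex v) {i j : Fin m} {p q c : Plane} :
    IsCenter v i j p q c ↔ bisectorFun v i j p q c = 0 ∧ ∀ ab ∈ centerConstraints p q (v i)
      (v (finRotate m i)) (v j) (v (finRotate m j)), 0 ≤ orient ab.1 ab.2 c := by
  have : IsCenter v i j p q c ↔ (Dominates v i p c ∧ Dominates v i c q ∧ Dominates v j q c ∧
      Dominates v j c p) ∧ bisectorFun v i j p q c = 0 :=
    ⟨fun h => ⟨⟨h.1, h.2, h.3, h.4⟩, h.5⟩, fun h => ⟨h.1.1, h.1.2.1, h.1.2.2.1, h.1.2.2.2, h.2⟩⟩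
  rw [this, and_comm, dominates_iff_orient hm hv (b := p), dominates_iff_orient hm hv (b := q),
    dominates_iff_orient' hm hv (b := q), dominates_iff_orient' hm hv (b := p)]
  simp only [centerConstraints, List.forall_mem_cons, List.not_mem_nil, false_imp_iff,
    implies_true, and_true]
  simp only [orient_rotate (v (finRotate m i)), orient_rotate (v (finRotate m j)),
    orient_swap_left (v (finRotate m i)) q, orient_swap_left q (v i),
    orient_swap_left (v (finRotate m j)) p, orient_swap_left p (v j), neg_nonneg]
  tauto

/-- Along the line of centers a larger step in a lexicographically negative direction gives a
smaller point, so the largest admissible step is optimal. The bound is kept as s * den ≤ num so that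
den = 0 can encode the absence of a bound. -/
theorem isLexLeast_of_ratio (hm : 3 ≤ m) (hv : IsCCWConvex v) {i j : Fin m} {p q c d : Plane}
    (hp : ∀ k, 0 < sideFun v k p) (hq : ∀ k, 0 < sideFun v k q)
    (hc : IsCenter v i j p q c) (he : bisectorDir v i j p q ≠ 0)
    (hd : d = bisectorDir v i j p q ∨ d = -bisectorDir v i j p q)
    (hlex : d 0 < 0 ∨ d 0 = 0 ∧ d 1 < 0) {num den : ℝ} (hnum : 0 ≤ num) (hden : 0 ≤ den)
    (h : ∀ s : ℝ, 0 ≤ s → (s * den ≤ num ↔ ∀ ab ∈ centerConstraints p q (v i)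
      (v (finRotate m i)) (v j) (v (finRotate m j)), 0 ≤ orient ab.1 ab.2 (c + s • d))) :
    den ≠ 0 ∧ IsLexLeast {c | IsCenter v i j p q c} (c + (num / den) • d) := by
  have hd0 : d ≠ 0 := by rcases hd with rfl | rfl <;> simpa
  have hcross : bisectorDir v i j p q 0 * d 1 - bisectorDir v i j p q 1 * d 0 = 0 := by
    rcases hd with rfl | rfl
    · ring
    · simp only [PiLp.neg_apply]; ring
  have h' : ∀ s : ℝ, 0 ≤ s → (s * den ≤ num ↔ IsCenter v i j p q (c + s • d)) := by
    intro s hs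
    rw [h s hs, isCenter_iff hm hv, bisectorFun_add, hc.bis, iff_and_self]
    intro _
    simp only [PiLp.smul_apply, smul_eq_mul]
    linear_combination s * hcross
  have hden' : den ≠ 0 := by
    -- Without a bound a whole ray would consist of centers, contradicting boundedness of the
    -- polygon.
    rintro rfl
    obtain ⟨R, hR⟩ := isBounded_isCenter hm hv hp hq (i := i) (j := j) (c := c) hd0
    have := hR (|R| + 1) ((h' _ (by positivity)).1 (by simpa using hnum))
    rw [abs_of_nonneg (by positivity)] at this
    linarith [le_abs_self R]
  refine ⟨hden', (h' _ (by positivity)).1 (by field_simp; rfl), fun x hx => ?_⟩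
  obtain ⟨s, rfl⟩ : ∃ s : ℝ, x = c + s • d := by
    obtain ⟨s, hs⟩ := hc.exists_smul hx he
    rcases hd with hd | hd
    · exact ⟨s, by rw [hd, hs]⟩
    · exact ⟨-s, by rw [hd, hs]; simp⟩
  have hle : s ≤ num / den := by
    rcases le_total 0 s with h0 | h0
    · rw [le_div_iff₀ (hden.lt_of_ne hden'.symm)]
      exact (h' s h0).2 hx
    · exact h0.trans (by positivity)
  simp only [LexLE, PiLp.add_apply, PiLp.smul_apply, smul_eq_mul]
  rcases hle.eq_or_lt with heq | hlt
  · right; rw [heq]; simp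
  · rcases hlex with h0 | ⟨h0, h1⟩
    · left; nlinarith
    · right; rw [h0]; constructor
      · simp
      · nlinarith

end Line

/-! ### Verification of programs -/

/-- `P` halts within `T` steps in a state satisfying `Q`. -/
def RamProg.Run (P : RamProg) (s : RamState) (T : ℕ) (Q : RamState → Prop) : Prop :=
  ∃ s' t, RamExec P s s' t ∧ t ≤ T ∧ Q s'

theorem RamProg.Run.seq {P P' : RamProg} {s : RamState} {T T' : ℕ} {Q R : RamState → Prop}
    (h : P.Run s T R) (h' : ∀ s', R s' → P'.Run s' T' Q) : (RamProg.seq P P').Run s (T + T') Q := by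
  obtain ⟨s1, t1, e1, l1, r1⟩ := h
  obtain ⟨s2, t2, e2, l2, r2⟩ := h' s1 r1
  exact ⟨s2, t1 + t2, .seq _ _ _ _ _ _ _ e1 e2, by omega, r2⟩

theorem RamProg.Run.mono {P : RamProg} {s : RamState} {T T' : ℕ} {Q Q' : RamState → Prop}
    (h : P.Run s T Q) (hT : T ≤ T') (hQ : ∀ s', Q s' → Q' s') : P.Run s T' Q' := by
  obtain ⟨s1, t1, e1, l1, r1⟩ := h
  exact ⟨s1, t1, e1, l1.trans hT, hQ _ r1⟩

/-- The largest cost of a path through a program without loops. -/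
def RamProg.maxCost : RamProg → ℕ
  | .skip => 1
  | .setN _ e => e.cost + 1
  | .setR _ e => e.cost + 1
  | .store a e => a.cost + e.cost + 1
  | .seq P Q => P.maxCost + Q.maxCost
  | .ite b P Q => b.cost + max P.maxCost Q.maxCost
  | .loop _ _ => 0

/-- The weakest precondition of a program without loops. -/
def RamProg.wp : RamProg → (RamState → Prop) → RamState → Prop
  | .skip, Q, s => Q s
  | .setN i e, Q, s => Q { s with nreg := Function.update s.nreg i (e.eval s) }
  | .setR i e, Q, s => ∃ x, e.eval s = some x ∧ Q { s with rreg := Function.update s.rreg i x }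
  | .store a e, Q, s =>
      ∃ x, e.eval s = some x ∧ Q { s with mem := Function.update s.mem (a.eval s) x }
  | .seq P P', Q, s => P.wp (P'.wp Q) s
  | .ite b P P', Q, s =>
      (b.eval s = some true ∧ P.wp Q s) ∨ (b.eval s = some false ∧ P'.wp Q s)
  | .loop _ _, _, _ => False

/-- Loop-free code costs at most the constant `maxCost`, so only the bisection loops contribute a
dependence on m. -/
theorem RamProg.wp.run {P : RamProg} {Q : RamState → Prop} {s : RamState} (h : P.wp Q s) :
    P.Run s P.maxCost Q := by
  induction P generalizing Q s with
  | skip => exact ⟨s, 1, .skip s, le_rfl, h⟩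
  | setN i e => exact ⟨_, _, .setN s i e, le_rfl, h⟩
  | setR i e =>
    obtain ⟨x, hx, h⟩ := h
    exact ⟨_, _, .setR s i e x hx, le_rfl, h⟩
  | store a e =>
    obtain ⟨x, hx, h⟩ := h
    exact ⟨_, _, .store s a e x hx, le_rfl, h⟩
  | seq P P' ih ih' => exact (ih h).seq fun s' h' => ih' h'
  | ite b P P' ih ih' =>
    rcases h with ⟨hb, h⟩ | ⟨hb, h⟩
    · obtain ⟨s1, t1, e1, l1, r1⟩ := ih h
      exact ⟨s1, _, .iteTrue _ _ _ _ _ _ hb e1,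
        Nat.add_le_add_left (l1.trans (le_max_left _ _)) _, r1⟩
    · obtain ⟨s1, t1, e1, l1, r1⟩ := ih' h
      exact ⟨s1, _, .iteFalse _ _ _ _ _ _ hb e1,
        Nat.add_le_add_left (l1.trans (le_max_right _ _)) _, r1⟩
  | loop b P => exact h.elim

theorem RamProg.wp_mono {P : RamProg} {Q Q' : RamState → Prop} {s : RamState} (h : P.wp Q s)
    (hQ : ∀ s', Q s' → Q' s') : P.wp Q' s := by
  induction P generalizing Q Q' s with
  | skip => exact hQ _ h
  | setN i e => exact hQ _ h
  | setR i e => exact h.imp fun x hx => ⟨hx.1, hQ _ hx.2⟩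
  | store a e => exact h.imp fun x hx => ⟨hx.1, hQ _ hx.2⟩
  | seq P P' ih ih' => exact ih h fun s' h' => ih' h' hQ
  | ite b P P' ih ih' => exact h.imp (fun h => ⟨h.1, ih h.2 hQ⟩) (fun h => ⟨h.1, ih' h.2 hQ⟩)
  | loop b P => exact h.elim

theorem RamProg.wp_seq {P P' : RamProg} {Q : RamState → Prop} {s : RamState} :
    (RamProg.seq P P').wp Q s = P.wp (P'.wp Q) s := rfl

theorem RamProg.wp_setN {i : ℕ} {e : NExpr} {Q : RamState → Prop} {s : RamState} :
    (RamProg.setN i e).wp Q s = Q { s with nreg := Function.update s.nreg i (e.eval s) } := rfl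

theorem RamProg.wp_setR {i : ℕ} {e : RExpr} {Q : RamState → Prop} {s : RamState} {x : ℝ}
    (h : e.eval s = some x) (hQ : Q { s with rreg := Function.update s.rreg i x }) :
    (RamProg.setR i e).wp Q s := ⟨x, h, hQ⟩

theorem RamProg.wp_ite_rle {a b : RExpr} {P P' : RamProg} {Q : RamState → Prop} {s : RamState}
    {x y : ℝ} (ha : a.eval s = some x) (hb : b.eval s = some y) (h : x ≤ y → P.wp Q s)
    (h' : y < x → P'.wp Q s) : (RamProg.ite (.rle a b) P P').wp Q s := by
  by_cases hxy : x ≤ y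
  · exact Or.inl ⟨by simp [RamTest.eval, ha, hb, hxy], h hxy⟩
  · exact Or.inr ⟨by simpa [RamTest.eval, ha, hb] using hxy, h' (not_le.1 hxy)⟩

theorem RamProg.wp_ite_rlt {a b : RExpr} {P P' : RamProg} {Q : RamState → Prop} {s : RamState}
    {x y : ℝ} (ha : a.eval s = some x) (hb : b.eval s = some y) (h : x < y → P.wp Q s)
    (h' : y ≤ x → P'.wp Q s) : (RamProg.ite (.rlt a b) P P').wp Q s := by
  by_cases hxy : x < y
  · exact Or.inl ⟨by simp [RamTest.eval, ha, hb, hxy], h hxy⟩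
  · exact Or.inr ⟨by simpa [RamTest.eval, ha, hb] using hxy, h' (not_lt.1 hxy)⟩

theorem RamTest.eval_nle_of_not_le {a b : NExpr} {s : RamState} (h : ¬ a.eval s ≤ b.eval s) :
    (RamTest.nle a b).eval s = some false := by
  simp [RamTest.eval, h]

theorem RExpr.eval_zero (s : RamState) : (RExpr.const 0).eval s = some 0 := by simp [RExpr.eval]

theorem RExpr.eval_div {a b : RExpr} {s : RamState} {x y : ℝ} (ha : a.eval s = some x)
    (hb : b.eval s = some y) (hy : y ≠ 0) : (RExpr.div a b).eval s = some (x / y) := by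
  simp [RExpr.eval, ha, hb, hy]

theorem RExpr.eval_sqrt {a : RExpr} {s : RamState} {x : ℝ} (ha : a.eval s = some x)
    (hx : 0 ≤ x) : (RExpr.sqrt a).eval s = some (Real.sqrt x) := by
  simp [RExpr.eval, ha, hx]

/-! ### Points in registers and in memory -/

/-- The point whose coordinates are in the real registers `k` and `k + 1`. -/
def RamState.pt (s : RamState) (k : ℕ) : Plane := !₂[s.rreg k, s.rreg (k + 1)]

/-- The point whose coordinates are in the memory cells `2 * k` and `2 * k + 1`. -/
def RamState.vtx (s : RamState) (k : ℕ) : Plane := !₂[s.mem (k + k), s.mem (k + k + 1)]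

/-- Expressions for the coordinates of a point in registers. -/
def regPt (k : ℕ) : RExpr × RExpr := (.reg k, .reg (k + 1))

/-- Expressions for the coordinates of a point in memory. -/
def cellPt (a : NExpr) : RExpr × RExpr :=
  (.cell (.add a a), .cell (.add (.add a a) (.const 1)))

/-- An expression for `orient`. -/
def orientExpr (a b c : RExpr × RExpr) : RExpr :=
  .sub (.mul (.sub b.1 a.1) (.sub c.2 a.2)) (.mul (.sub b.2 a.2) (.sub c.1 a.1))

@[simp] theorem eval_orientExpr_reg (s : RamState) (i j k : ℕ) :
    (orientExpr (regPt i) (regPt j) (regPt k)).eval s =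
      some (orient (s.pt i) (s.pt j) (s.pt k)) := by
  simp [orientExpr, regPt, RExpr.eval, RamState.pt, orient]

@[simp] theorem eval_orientExpr_cell (s : RamState) (i j : ℕ) (a : NExpr) :
    (orientExpr (regPt i) (regPt j) (cellPt a)).eval s =
      some (orient (s.pt i) (s.pt j) (s.vtx (a.eval s))) := by
  simp [orientExpr, regPt, cellPt, RExpr.eval, NExpr.eval, RamState.pt, RamState.vtx, orient]

theorem RamState.pt_congr {s s' : RamState} {k : ℕ} (h : s'.rreg k = s.rreg k)
    (h' : s'.rreg (k + 1) = s.rreg (k + 1)) : s'.pt k = s.pt k := by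
  simp [RamState.pt, h, h']

/-! ### Bisection -/

/-- One step of the bisection; the interval is kept in the integer registers `1` and `2`. -/
def bisectStep : RamProg :=
  .seq (.setN 4 (.half (.add (.reg 1) (.reg 2))))
    (.ite (.rle (orientExpr (regPt 40) (regPt 42) (cellPt (.reg 4))) (.const 0))
      (.setN 1 (.reg 4)) (.setN 2 (.reg 4)))

/-- The test of the bisection loop. -/
def bisectTest : RamTest := .nle (.add (.reg 1) (.const 2)) (.reg 2)

/-- Bisection for a sign change of the orientation with respect to the points in the real
registers `40, 41` and `42, 43`. -/
def bisect : RamProg := .loop bisectTest bisectStep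

/-- The cost of one round of the bisection. -/
def bisectCost : ℕ := bisectTest.cost + bisectStep.maxCost

/-- The state `s'` arises from `s` by a search: registers used otherwise are untouched. -/
structure SearchFrame (s s' : RamState) : Prop where
  rreg : ∀ k < 40, s'.rreg k = s.rreg k
  mem : s'.mem = s.mem
  nreg0 : s'.nreg 0 = s.nreg 0
  nreg3 : s'.nreg 3 = s.nreg 3

/-- The result of a search for a sign change of `f` between `l` and `h`. -/
structure SignChange (f : ℕ → ℝ) (l h : ℕ) (s' : RamState) : Prop where
  ge : l ≤ s'.nreg 1
  succ : s'.nreg 2 = s'.nreg 1 + 1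
  le : s'.nreg 2 ≤ h
  nonpos : f (s'.nreg 1) ≤ 0
  nonneg : 0 ≤ f (s'.nreg 2)

theorem bisectStep_wp (s : RamState) (Q : RamState → Prop)
    (h : ∀ s', s'.rreg = s.rreg → s'.mem = s.mem → s'.nreg 0 = s.nreg 0 → s'.nreg 3 = s.nreg 3 →
      ((orient (s.pt 40) (s.pt 42) (s.vtx ((s.nreg 1 + s.nreg 2) / 2)) ≤ 0 ∧
          s'.nreg 1 = (s.nreg 1 + s.nreg 2) / 2 ∧ s'.nreg 2 = s.nreg 2) ∨
        (0 ≤ orient (s.pt 40) (s.pt 42) (s.vtx ((s.nreg 1 + s.nreg 2) / 2)) ∧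
          s'.nreg 1 = s.nreg 1 ∧ s'.nreg 2 = (s.nreg 1 + s.nreg 2) / 2)) → Q s') :
    bisectStep.wp Q s := by
  unfold bisectStep
  rw [RamProg.wp_seq, RamProg.wp_setN]
  refine RamProg.wp_ite_rle (eval_orientExpr_cell _ _ _ _) (RExpr.eval_zero _) (fun hle => ?_) (fun hlt => ?_)
  · exact h _ rfl rfl (by simp) (by simp) (Or.inl ⟨by
      simpa [NExpr.eval, RamState.pt, RamState.vtx] using hle, by simp [NExpr.eval], by simp⟩)
  · exact h _ rfl rfl (by simp) (by simp) (Or.inr ⟨by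
      simpa [NExpr.eval, RamState.pt, RamState.vtx] using hlt.le, by simp, by simp [NExpr.eval]⟩)

/-- The invariant keeps weakly opposite signs at the ends, so no monotonicity of the orientations is
needed. Each round reduces a length bound of 2 ^ (n + 1) to 2 ^ n; the extra round in the bound pays
for the final failing test. -/
theorem bisect_run (n : ℕ) (s : RamState) (hlt : s.nreg 1 < s.nreg 2)
    (hn : s.nreg 2 ≤ s.nreg 1 + 2 ^ n)
    (h1 : orient (s.pt 40) (s.pt 42) (s.vtx (s.nreg 1)) ≤ 0)
    (h2 : 0 ≤ orient (s.pt 40) (s.pt 42) (s.vtx (s.nreg 2))) :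
    bisect.Run s (bisectCost * (n + 1)) fun s' => SearchFrame s s' ∧
      SignChange (fun k => orient (s.pt 40) (s.pt 42) (s.vtx k)) (s.nreg 1) (s.nreg 2) s' := by
  induction n generalizing s with
  | zero =>
    rw [pow_zero] at hn
    refine ⟨s, _, .loopFalse _ _ _ ?_, ?_, ⟨fun _ _ => rfl, rfl, rfl, rfl⟩,
      le_rfl, by omega, le_rfl, h1, h2⟩
    · exact RamTest.eval_nle_of_not_le (by simp only [NExpr.eval]; omega)
    · simp [bisectCost]
  | succ n ih =>
    by_cases hle : s.nreg 1 + 2 ≤ s.nreg 2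
    · rw [pow_succ] at hn
      have hstep : bisectStep.Run s bisectStep.maxCost fun s1 =>
          bisect.Run s1 (bisectCost * (n + 1)) fun s' => SearchFrame s s' ∧
            SignChange (fun k => orient (s.pt 40) (s.pt 42) (s.vtx k)) (s.nreg 1) (s.nreg 2) s' := by
        refine (bisectStep_wp s _ fun s1 hr hm h0 h3 hcase => ?_).run
        have hp : ∀ k, s1.pt k = s.pt k := fun k => by simp [RamState.pt, hr]
        have hv : ∀ k, s1.vtx k = s.vtx k := fun k => by simp [RamState.vtx, hm]
        have := ih s1 (by omega) (by omega)
          (by rw [hp, hp, hv]; rcases hcase with ⟨h, e1, e2⟩ | ⟨h, e1, e2⟩ <;> rw [e1] <;> assumption)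
          (by rw [hp, hp, hv]; rcases hcase with ⟨h, e1, e2⟩ | ⟨h, e1, e2⟩ <;> rw [e2] <;> assumption)
        refine this.mono le_rfl fun s' ⟨hf, hs⟩ => ⟨⟨fun k hk => ?_, ?_, ?_, ?_⟩, ?_, hs.succ, ?_, ?_, ?_⟩
        · rw [hf.rreg k hk, hr]
        · rw [hf.mem, hm]
        · rw [hf.nreg0, h0]
        · rw [hf.nreg3, h3]
        · have := hs.ge; omega
        · have := hs.le; omega
        · simpa [hp, hv] using hs.nonpos
        · simpa [hp, hv] using hs.nonneg
      obtain ⟨s1, t1, e1, l1, s2, t2, e2, l2, r⟩ := hstep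
      refine ⟨s2, _, .loopTrue _ _ _ _ _ _ _ ?_ e1 e2, ?_, r⟩
      · simp [bisectTest, RamTest.eval, NExpr.eval, hle]
      · have : bisectTest.cost + t1 ≤ bisectCost := by unfold bisectCost; omega
        rw [mul_add_one bisectCost (n + 1)]
        omega
    · refine ⟨s, _, .loopFalse _ _ _ ?_, ?_, ⟨fun _ _ => rfl, rfl, rfl, rfl⟩,
        le_rfl, by omega, le_rfl, h1, h2⟩
      · exact RamTest.eval_nle_of_not_le (by simp only [NExpr.eval]; omega)
      · have : bisectTest.cost ≤ bisectCost := by unfold bisectCost; omega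
        nlinarith

/-- Preparation of a bisection of the interval `[lo, hi]` with respect to the points in the real
registers `a` and `b`. -/
def prepareSearch (a b : ℕ) (lo hi : NExpr) : RamProg :=
  .seq (.setR 40 (.reg a)) (.seq (.setR 41 (.reg (a + 1))) (.seq (.setR 42 (.reg b))
    (.seq (.setR 43 (.reg (b + 1))) (.seq (.setN 1 lo) (.setN 2 hi)))))

/-- Registers 40 to 43 hold working copies, hence the bounds on a and b. The interval ends are
evaluated during the preparation and may depend only on integer registers 0 and 3, which it leaves
unchanged. -/
theorem search_run {a b : ℕ} {lo hi : NExpr} {l h n : ℕ} (s : RamState) (ha : a < 39) (hb : b < 39)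
    (hlo : ∀ s' : RamState, s'.nreg 0 = s.nreg 0 → s'.nreg 3 = s.nreg 3 → lo.eval s' = l)
    (hhi : ∀ s' : RamState, s'.nreg 0 = s.nreg 0 → s'.nreg 3 = s.nreg 3 → hi.eval s' = h)
    (hlt : l < h) (hn : h ≤ l + 2 ^ n) (h1 : orient (s.pt a) (s.pt b) (s.vtx l) ≤ 0)
    (h2 : 0 ≤ orient (s.pt a) (s.pt b) (s.vtx h)) :
    (RamProg.seq (prepareSearch a b lo hi) bisect).Run s
      ((prepareSearch a b lo hi).maxCost + bisectCost * (n + 1)) fun s' => SearchFrame s s' ∧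
      SignChange (fun k => orient (s.pt a) (s.pt b) (s.vtx k)) l h s' := by
  have hprep : (prepareSearch a b lo hi).wp (fun s' => SearchFrame s s' ∧ s'.nreg 1 = l ∧
      s'.nreg 2 = h ∧ s'.pt 40 = s.pt a ∧ s'.pt 42 = s.pt b) s := by
    simp only [prepareSearch, RamProg.wp, RExpr.eval, Option.some.injEq, exists_eq_left']
    have hlo' : ∀ r, lo.eval { s with rreg := r } = l := fun r => hlo _ rfl rfl
    have hhi' : ∀ r x, hi.eval { s with nreg := Function.update s.nreg 1 x, rreg := r } = h :=
      fun r x => hhi _ (by simp) (by simp)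
    simp only [hlo', hhi']
    have e1 : a ≠ 40 := by omega
    have e2 : a ≠ 39 := by omega
    have e3 : b ≠ 40 := by omega
    have e4 : b ≠ 39 := by omega
    have e5 : b ≠ 41 := by omega
    have e6 : b ≠ 42 := by omega
    refine ⟨⟨fun k hk => ?_, rfl, ?_, ?_⟩, ?_, ?_, ?_, ?_⟩
    · have : k ≠ 40 ∧ k ≠ 41 ∧ k ≠ 42 ∧ k ≠ 43 := by omega
      simp [Function.update_apply, this]
    · simp
    · simp
    · simp
    · simp
    · simp [RamState.pt, *]
    · simp [RamState.pt, *]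
  refine hprep.run.seq fun s1 ⟨hf, e1, e2, e3, e4⟩ => ?_
  have hv : ∀ k, s1.vtx k = s.vtx k := fun k => by simp [RamState.vtx, hf.mem]
  have := bisect_run n s1 (by omega) (by omega) (by rwa [e1, e3, e4, hv]) (by rwa [e2, e3, e4, hv])
  refine this.mono le_rfl fun s' ⟨hf', hs⟩ => ⟨⟨fun k hk => ?_, ?_, ?_, ?_⟩, ?_⟩
  · rw [hf'.rreg k hk, hf.rreg k hk]
  · rw [hf'.mem, hf.mem]
  · rw [hf'.nreg0, hf.nreg0]
  · rw [hf'.nreg3, hf.nreg3]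
  · simpa only [e1, e2, e3, e4, hv] using hs

/-! ### The program and its verification -/

section Program

variable {m : ℕ} {v : Fin m → Plane}

/-- The input is in place, with the memory extended by a second copy of the first vertex. -/
structure Ready (v : Fin m → Plane) (p q : Plane) (s : RamState) : Prop where
  nreg0 : s.nreg 0 = m
  p0 : s.pt 0 = p
  q0 : s.pt 2 = q
  vtx : ∀ k ≤ m, s.vtx k = vertexSeq v k

theorem Ready.frame {p q : Plane} {s s' : RamState} (h : Ready v p q s) (hn : s'.nreg 0 = s.nreg 0)
    (hm : s'.mem = s.mem) (hr : ∀ k < 4, s'.rreg k = s.rreg k) : Ready v p q s' where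
  nreg0 := hn.trans h.nreg0
  p0 := by rw [← h.p0]; exact RamState.pt_congr (hr _ (by omega)) (hr _ (by omega))
  q0 := by rw [← h.q0]; exact RamState.pt_congr (hr _ (by omega)) (hr _ (by omega))
  vtx k hk := by rw [← h.vtx k hk]; simp [RamState.vtx, hm]

theorem SearchFrame.ready {p q : Plane} {s s' : RamState} (hf : SearchFrame s s')
    (h : Ready v p q s) : Ready v p q s' :=
  h.frame hf.nreg0 hf.mem fun k hk => hf.rreg k (by omega)

theorem SearchFrame.pt {s s' : RamState} (hf : SearchFrame s s') {k : ℕ} (hk : k < 39) :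
    s'.pt k = s.pt k :=
  RamState.pt_congr (hf.rreg _ (by omega)) (hf.rreg _ (by omega))

theorem vertexSeq_self (hm : 3 ≤ m) : vertexSeq v m = vertexSeq v 0 := by
  simp [vertexSeq, show 0 < m by omega]

/-- Exchange of the two given points. -/
def swapPoints : RamProg :=
  .seq (.setR 4 (.reg 0)) (.seq (.setR 5 (.reg 1)) (.seq (.setR 0 (.reg 2)) (.seq (.setR 1 (.reg 3))
    (.seq (.setR 2 (.reg 4)) (.setR 3 (.reg 5))))))

theorem swapPoints_wp (s : RamState) : swapPoints.wp (fun s' => s'.nreg = s.nreg ∧ s'.mem = s.mem ∧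
    s'.pt 0 = s.pt 2 ∧ s'.pt 2 = s.pt 0 ∧ s'.pt 16 = s.pt 16) s := by
  simp [swapPoints, RamProg.wp, RExpr.eval, RamState.pt]

/-- Appends the first vertex to the array and loads it into the real registers `16` and `17`. -/
def closeArray : RamProg :=
  .seq (.store (.add (.reg 0) (.reg 0)) (.cell (.const 0)))
    (.seq (.store (.add (.add (.reg 0) (.reg 0)) (.const 1)) (.cell (.const 1)))
      (.seq (.setR 16 (.cell (.const 0))) (.setR 17 (.cell (.const 1)))))

/-- Closes the array, and exchanges the given points if necessary, so that the first vertex does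
not lie to the left of the directed line through them. -/
def initProg : RamProg :=
  .seq closeArray
    (.ite (.rlt (.const 0) (orientExpr (regPt 0) (regPt 2) (regPt 16))) swapPoints .skip)

theorem initProg_wp (hm : 3 ≤ m) (p q : Plane) : initProg.wp (fun s' => ∃ p' q',
    ((p' = p ∧ q' = q) ∨ (p' = q ∧ q' = p)) ∧ Ready v p' q' s' ∧ s'.pt 16 = vertexSeq v 0 ∧
      orient p' q' (vertexSeq v 0) ≤ 0) (ramInput v p q) := by
  have hstore : closeArray.wp (fun s' => Ready v p q s' ∧ s'.pt 16 = vertexSeq v 0)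
      (ramInput v p q) := by
    have h0 : 0 < m := by omega
    simp only [closeArray, RamProg.wp, RExpr.eval, NExpr.eval, Option.some.injEq,
      exists_eq_left']
    have e1 : ¬ 1 = m + m := by omega
    have e2 : ¬ 0 = m + m := by omega
    refine ⟨⟨?_, ?_, ?_, fun k hk => ?_⟩, ?_⟩
    · simp [ramInput]
    · apply plane_ext <;> simp [ramInput, RamState.pt]
    · apply plane_ext <;> simp [ramInput, RamState.pt]
    · rcases hk.eq_or_lt with rfl | hlt
      -- Index m addresses the appended copy of the first vertex, which lets a search run across the
      -- closing side.
      · rw [vertexSeq_self hm, vertexSeq_of_lt h0]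
        apply plane_ext <;> simp [ramInput, RamState.vtx, h0, e1]
      · rw [vertexSeq_of_lt hlt]
        have a1 : ¬ k + k = m + m := by omega
        have a2 : ¬ k + k = m + m + 1 := by omega
        have a3 : ¬ k + k + 1 = m + m := by omega
        have a5 : (k + k) / 2 = k := by omega
        have a6 : (k + k + 1) / 2 = k := by omega
        have a7 : (k + k + 1) % 2 = 1 := by omega
        have a8 : (k + k) % 2 = 0 := by omega
        apply plane_ext <;>
          simp [ramInput, RamState.vtx, Function.update_apply, a1, a2, a3, a5, a6, a7, a8, hlt]
    · rw [vertexSeq_of_lt h0]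
      apply plane_ext <;> simp [ramInput, RamState.pt, Function.update_apply, h0, e1, e2]
  rw [initProg, RamProg.wp_seq]
  refine RamProg.wp_mono hstore fun s ⟨hs, hs0⟩ => ?_
  refine RamProg.wp_ite_rlt (RExpr.eval_zero _) (eval_orientExpr_reg _ _ _ _) (fun h => ?_)
    (fun h => ?_)
  · rw [hs.p0, hs.q0, hs0] at h
    refine RamProg.wp_mono (swapPoints_wp s) fun s' ⟨en, em, ep, eq, e0⟩ => ?_
    refine ⟨q, p, Or.inr ⟨rfl, rfl⟩, ⟨?_, ?_, ?_, fun k hk => ?_⟩, ?_, ?_⟩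
    · rw [en, hs.nreg0]
    · rw [ep, hs.q0]
    · rw [eq, hs.p0]
    · rw [← hs.vtx k hk]; simp [RamState.vtx, em]
    · rw [e0, hs0]
    · rw [orient_swap_left]; linarith
  · rw [hs.p0, hs.q0, hs0] at h
    exact ⟨p, q, Or.inl ⟨rfl, rfl⟩, hs, hs0, h⟩

/-- Chooses a vertex that does not lie to the right of the directed line through the given points
among the two ends of the side found by the first search. -/
def chooseProg : RamProg :=
  .ite (.rle (.const 0) (orientExpr (regPt 0) (regPt 2) (cellPt (.reg 1)))) (.setN 3 (.reg 1))
    (.setN 3 (.reg 2))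

theorem chooseProg_wp (s : RamState) : chooseProg.wp (fun s' => s'.rreg = s.rreg ∧ s'.mem = s.mem ∧
    s'.nreg 0 = s.nreg 0 ∧ ((s'.nreg 3 = s.nreg 1 ∧
        0 ≤ orient (s.pt 0) (s.pt 2) (s.vtx (s.nreg 1))) ∨
      (s'.nreg 3 = s.nreg 2 ∧ orient (s.pt 0) (s.pt 2) (s.vtx (s.nreg 1)) < 0))) s := by
  refine RamProg.wp_ite_rle (RExpr.eval_zero _) (eval_orientExpr_cell _ _ _ _) (fun h => ?_)
    (fun h => ?_)
  · exact ⟨rfl, rfl, by simp, Or.inl ⟨by simp [NExpr.eval], h⟩⟩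
  · exact ⟨rfl, rfl, by simp, Or.inr ⟨by simp [NExpr.eval], h⟩⟩

/-- Loads the ends of the side found by a search into the real registers `d, …, d + 3`. -/
def loadSide (d : ℕ) : RamProg :=
  .seq (.setR d (cellPt (.reg 1)).1) (.seq (.setR (d + 1) (cellPt (.reg 1)).2)
    (.seq (.setR (d + 2) (cellPt (.reg 2)).1) (.setR (d + 3) (cellPt (.reg 2)).2)))

theorem loadSide_wp (d : ℕ) (s : RamState) : (loadSide d).wp (fun s' => s'.nreg = s.nreg ∧
    s'.mem = s.mem ∧ (∀ k < d, s'.rreg k = s.rreg k) ∧ s'.pt d = s.vtx (s.nreg 1) ∧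
      s'.pt (d + 2) = s.vtx (s.nreg 2)) s := by
  simp only [loadSide, RamProg.wp, RExpr.eval, NExpr.eval, cellPt, Option.some.injEq,
    exists_eq_left']
  refine ⟨trivial, trivial, fun k hk => ?_, ?_, ?_⟩
  · have : k ≠ d ∧ k ≠ d + 1 ∧ k ≠ d + 2 ∧ k ≠ d + 3 := by omega
    simp [this]
  · simp [RamState.pt, RamState.vtx]
  · simp [RamState.pt, RamState.vtx]

/-- A step of the orientation from nonpositive to nonnegative between consecutive vertices is the
criterion `dominates_iff_orient`. -/
theorem dominates_of_signChange (hm : 3 ≤ m) (hv : IsCCWConvex v) {a b : Plane} {l h : ℕ}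
    {s : RamState} (hs : SignChange (fun k => orient a b (vertexSeq v k)) l h s) (hh : h ≤ m) :
    ∃ i : Fin m, Dominates v i a b ∧ vertexSeq v (s.nreg 1) = v i ∧
      vertexSeq v (s.nreg 2) = v (finRotate m i) := by
  have h1 := hs.succ
  have h2 := hs.le
  have hlt : s.nreg 1 < m := by omega
  have e1 : vertexSeq v (s.nreg 1) = v ⟨s.nreg 1, hlt⟩ := vertexSeq_of_lt hlt
  have e2 : vertexSeq v (s.nreg 2) = v (finRotate m ⟨s.nreg 1, hlt⟩) := by
    rw [h1]; exact vertexSeq_succ ⟨s.nreg 1, hlt⟩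
  refine ⟨⟨s.nreg 1, hlt⟩, (dominates_iff_orient hm hv).2 ⟨?_, ?_⟩, e1, e2⟩
  · rw [← e2]; exact hs.nonneg
  · rw [orient_swap_right, ← e1, neg_nonneg]; exact hs.nonpos

theorem sideSearch_run (hm : 3 ≤ m) (hv : IsCCWConvex v) {p q : Plane} {a b d : ℕ} {lo hi : NExpr}
    {l h n : ℕ} {s : RamState} (hs : Ready v p q s) (ha : a < 39) (hb : b < 39) (hd : 8 ≤ d)
    (hd' : d < 40)
    (hlo : ∀ s' : RamState, s'.nreg 0 = s.nreg 0 → s'.nreg 3 = s.nreg 3 → lo.eval s' = l)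
    (hhi : ∀ s' : RamState, s'.nreg 0 = s.nreg 0 → s'.nreg 3 = s.nreg 3 → hi.eval s' = h)
    (hlt : l < h) (hh : h ≤ m) (hn : m ≤ 2 ^ n)
    (h1 : orient (s.pt a) (s.pt b) (vertexSeq v l) ≤ 0)
    (h2 : 0 ≤ orient (s.pt a) (s.pt b) (vertexSeq v h)) :
    (RamProg.seq (RamProg.seq (prepareSearch a b lo hi) bisect) (loadSide d)).Run s
      (((prepareSearch a b lo hi).maxCost + bisectCost * (n + 1)) + (loadSide d).maxCost) fun s' =>
      Ready v p q s' ∧ s'.nreg 3 = s.nreg 3 ∧ (∀ k < d, s'.rreg k = s.rreg k) ∧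
      ∃ i : Fin m, Dominates v i (s.pt a) (s.pt b) ∧ s'.pt d = v i ∧
        s'.pt (d + 2) = v (finRotate m i) := by
  refine (search_run s ha hb hlo hhi hlt (by omega) (by rwa [hs.vtx _ (by omega)])
    (by rwa [hs.vtx _ hh])).seq fun s1 ⟨hf, hc⟩ => ?_
  have hr1 := hf.ready hs
  have hc' : SignChange (fun k => orient (s.pt a) (s.pt b) (vertexSeq v k)) l h s1 := by
    have := hc.succ
    have := hc.le
    refine ⟨hc.ge, hc.succ, hc.le, ?_, ?_⟩
    · rw [← hs.vtx _ (by omega)]; exact hc.nonpos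
    · rw [← hs.vtx _ (by omega)]; exact hc.nonneg
  obtain ⟨i, hi1, hi2, hi3⟩ := dominates_of_signChange hm hv hc' hh
  refine (loadSide_wp d s1).run.mono le_rfl fun s' ⟨en, em, er, e1, e2⟩ => ?_
  have := hc.succ
  have := hc.le
  refine ⟨hr1.frame (by rw [en]) em fun k hk => er k (by omega), by rw [en, hf.nreg3],
    fun k hk => ?_, i, hi1, ?_, ?_⟩
  · rw [er k hk, hf.rreg k (by omega)]
  · rw [e1, hr1.vtx _ (by omega), hi2]
  · rw [e2, hr1.vtx _ (by omega), hi3]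

/-- If the first vertex does not lie to the left of the line `p q` and the ray from it through `p`
leaves the polygon through the side `k`, then one of the ends of this side does not lie to the right
of that line. -/
theorem orient_succ_nonneg (hm : 3 ≤ m) (hv : IsCCWConvex v) {p q : Plane}
    (hp : ∀ k, 0 < sideFun v k p) {k : ℕ} (hk : 1 ≤ k) (hk' : k + 1 < m)
    (h1 : orient (vertexSeq v 0) p (vertexSeq v k) ≤ 0)
    (h2 : 0 ≤ orient (vertexSeq v 0) p (vertexSeq v (k + 1)))
    (h0 : orient p q (vertexSeq v 0) ≤ 0) (hneg : orient p q (vertexSeq v k) < 0) :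
    0 ≤ orient p q (vertexSeq v (k + 1)) := by
  have h3 := hp ⟨k, by omega⟩
  rw [← orient_vertexSeq] at h3
  have h4 : 0 < orient (vertexSeq v 0) (vertexSeq v k) (vertexSeq v (k + 1)) := by
    rw [vertexSeq_of_lt (by omega), vertexSeq_of_lt (show k < m by omega), vertexSeq_of_lt hk']
    exact hv _ _ _ (by rw [Fin.lt_def]; exact hk) (by rw [Fin.lt_def]; simp)
  simp only at h3
  have hpa : p ≠ vertexSeq v 0 := by
    rintro rfl
    have := hp ⟨0, by omega⟩
    rw [vertexSeq_of_lt (by omega)] at this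
    simp [sideFun] at this
  clear hp
  generalize vertexSeq v 0 = a at *
  generalize vertexSeq v k = b at *
  generalize vertexSeq v (k + 1) = c at *
  -- The function orient p q vanishes at p, and p is the combination of a, b, c with these weights,
  -- which are nonnegative. If c too lay strictly to the right, every term would vanish, making p
  -- collinear with both a, b and a, c, so p = a.
  have key : orient b c p * orient p q a + orient a p c * orient p q b +
      (-orient a p b) * orient p q c = 0 := by
    simp only [orient]; ring
  by_contra! hneg'
  have e0 := mul_nonpos_of_nonneg_of_nonpos h3.le h0
  have e1 := mul_nonpos_of_nonneg_of_nonpos h2 hneg.le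
  have e2 := mul_nonpos_of_nonneg_of_nonpos (neg_nonneg.2 h1) hneg'.le
  have z1 : orient a p c = 0 :=
    (mul_eq_zero.1 (show orient a p c * orient p q b = 0 by linarith)).resolve_right hneg.ne
  have z2 : orient a p b = 0 := neg_eq_zero.1
    ((mul_eq_zero.1 (show -orient a p b * orient p q c = 0 by linarith)).resolve_right hneg'.ne)
  apply hpa
  simp only [orient] at z1 z2 h4
  apply plane_ext
  · refine mul_left_cancel₀ h4.ne' ?_
    linear_combination (b 0 - a 0) * z1 - (c 0 - a 0) * z2
  · refine mul_left_cancel₀ h4.ne' ?_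
    linear_combination (b 1 - a 1) * z1 - (c 1 - a 1) * z2

/-- Finds a side through which the ray from `p` through `q` leaves the polygon and one through which
the opposite ray does. -/
def searchProg : RamProg :=
  .seq (.seq (prepareSearch 16 0 (.const 1) (.sub (.reg 0) (.const 1))) bisect)
    (.seq chooseProg
      (.seq (.seq (.seq (prepareSearch 0 2 (.const 0) (.reg 3)) bisect) (loadSide 8))
        (.seq (.seq (prepareSearch 2 0 (.reg 3) (.reg 0)) bisect) (loadSide 12))))

/-- The cost of `searchProg` outside of its loops. -/
def searchCost : ℕ :=
  (prepareSearch 16 0 (.const 1) (.sub (.reg 0) (.const 1))).maxCost + chooseProg.maxCost +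
    (prepareSearch 0 2 (.const 0) (.reg 3)).maxCost + (loadSide 8).maxCost +
    (prepareSearch 2 0 (.reg 3) (.reg 0)).maxCost + (loadSide 12).maxCost

/-- The sides through which the line through the given points leaves the polygon are in the real
registers `8, …, 15`. -/
structure SidesFound (v : Fin m → Plane) (p q : Plane) (i j : Fin m) (s : RamState) : Prop where
  p0 : s.pt 0 = p
  q0 : s.pt 2 = q
  domi : Dominates v i p q
  domj : Dominates v j q p
  i0 : s.pt 8 = v i
  i1 : s.pt 10 = v (finRotate m i)
  j0 : s.pt 12 = v j
  j1 : s.pt 14 = v (finRotate m j)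

theorem searchProg_run (hm : 3 ≤ m) (hv : IsCCWConvex v) {p q : Plane} {n : ℕ} {s : RamState}
    (hp : ∀ k, 0 < sideFun v k p) (hs : Ready v p q s) (hs0 : s.pt 16 = vertexSeq v 0)
    (h0 : orient p q (vertexSeq v 0) ≤ 0) (hn : m ≤ 2 ^ n) :
    searchProg.Run s (searchCost + 3 * bisectCost * (n + 1)) fun s' =>
      ∃ i j : Fin m, SidesFound v p q i j s' := by
  have hfirst : orient (vertexSeq v 0) p (vertexSeq v 1) ≤ 0 := by
    have := hp ⟨0, by omega⟩
    rw [← orient_vertexSeq] at this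
    rw [orient_swap_right]
    simp only [zero_add] at this
    linarith
  have hlast : 0 ≤ orient (vertexSeq v 0) p (vertexSeq v (m - 1)) := by
    have := hp ⟨m - 1, by omega⟩
    rw [← orient_vertexSeq] at this
    simp only [show m - 1 + 1 = m by omega, vertexSeq_self hm] at this
    rw [orient_rotate]; exact this.le
  have hrun1 := search_run (a := 16) (b := 0) (lo := .const 1) (hi := .sub (.reg 0) (.const 1))
    (l := 1) (h := m - 1) (n := n) s (by omega) (by omega) (fun _ _ _ => rfl)
    (fun s' e _ => by simp only [NExpr.eval]; rw [e, hs.nreg0]) (by omega) (by omega)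
    (by rw [hs0, hs.p0, hs.vtx _ (by omega)]; exact hfirst)
    (by rw [hs0, hs.p0, hs.vtx _ (by omega)]; exact hlast)
  have hrun := hrun1.seq (P' := .seq chooseProg
      (.seq (.seq (.seq (prepareSearch 0 2 (.const 0) (.reg 3)) bisect) (loadSide 8))
        (.seq (.seq (prepareSearch 2 0 (.reg 3) (.reg 0)) bisect) (loadSide 12))))
    (Q := fun s' => ∃ i j : Fin m, SidesFound v p q i j s')
    (T' := chooseProg.maxCost + (((prepareSearch 0 2 (.const 0) (.reg 3)).maxCost +
      bisectCost * (n + 1)) + (loadSide 8).maxCost +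
      (((prepareSearch 2 0 (.reg 3) (.reg 0)).maxCost +
      bisectCost * (n + 1)) + (loadSide 12).maxCost))) ?_
  · exact hrun.mono (by unfold searchCost; linarith) fun _ h => h
  rintro s1 ⟨hf1, hc1⟩
  have hr1 := hf1.ready hs
  refine (chooseProg_wp s1).run.seq fun s2 ⟨er, em, e0, hb⟩ => ?_
  have hr2 := hr1.frame e0 em fun k _ => by rw [er]
  -- The chosen vertex is not the first one and lies weakly to the left, so it splits the closed
  -- vertex sequence into two intervals, each with a sign change for one direction of the line.
  have hb' : 0 < s2.nreg 3 ∧ s2.nreg 3 < m ∧ 0 ≤ orient p q (vertexSeq v (s2.nreg 3)) := by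
    have i1 := hc1.ge
    have i2 := hc1.succ
    have i3 := hc1.le
    have c1 := hc1.nonpos
    have c2 := hc1.nonneg
    rw [i2] at c2
    simp only [hs0, hs.p0] at c1 c2
    rw [hs.vtx _ (by omega)] at c1 c2
    rw [hr1.p0, hr1.q0, hr1.vtx _ (by omega)] at hb
    rcases hb with ⟨h3, h⟩ | ⟨h3, h⟩
    · rw [h3]; exact ⟨by omega, by omega, h⟩
    · rw [h3, i2]
      exact ⟨by omega, by omega, orient_succ_nonneg hm hv hp i1 (by omega) c1 c2 h0 h⟩
  obtain ⟨b0, bm, hb⟩ := hb'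
  refine (sideSearch_run hm hv hr2 (a := 0) (b := 2) (d := 8) (lo := .const 0)
    (hi := .reg 3) (l := 0) (h := s2.nreg 3) (n := n)
    (by omega) (by omega) (by omega) (by omega) (fun _ _ _ => rfl) (fun s' _ e => e) b0 bm.le hn
    (by rw [hr2.p0, hr2.q0]; exact h0) (by rw [hr2.p0, hr2.q0]; exact hb)).seq ?_
  rintro s3 ⟨hr3, e3, ef3, i, hi, hi0, hi1⟩
  refine (sideSearch_run hm hv hr3 (a := 2) (b := 0) (d := 12) (lo := .reg 3)
    (hi := .reg 0) (l := s2.nreg 3) (h := m) (n := n)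
    (by omega) (by omega) (by omega) (by omega) (fun s' _ e => e.trans e3)
    (fun s' e _ => e.trans hr3.nreg0) bm le_rfl hn
    (by rw [hr3.p0, hr3.q0, orient_swap_left]; linarith)
    (by rw [hr3.p0, hr3.q0, orient_swap_left, vertexSeq_self hm]; linarith)).mono le_rfl ?_
  rintro s4 ⟨hr4, -, ef4, j, hj, hj0, hj1⟩
  rw [hr2.p0, hr2.q0] at hi
  rw [hr3.p0, hr3.q0] at hj
  refine ⟨i, j, hr4.p0, hr4.q0, hi, hj, ?_, ?_, hj0, hj1⟩
  · rw [← hi0]; exact RamState.pt_congr (ef4 _ (by omega)) (ef4 _ (by omega))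
  · rw [← hi1]; exact RamState.pt_congr (ef4 _ (by omega)) (ef4 _ (by omega))

end Program

/-! ### The final computation -/

section Final

variable {m : ℕ} {v : Fin m → Plane}

/-- The square root of the product of the side functions of the given points, for the side in the
real registers `d, …, d + 3`. -/
def sqrtExpr (d : ℕ) : RExpr :=
  .sqrt (.mul (orientExpr (regPt d) (regPt (d + 2)) (regPt 0))
    (orientExpr (regPt d) (regPt (d + 2)) (regPt 2)))

/-- The value of `bisectorFun` at the point in the real registers `k` and `k + 1`. -/
def bisectorExpr (k : ℕ) : RExpr :=
  .sub (.mul (.reg 22) (orientExpr (regPt 8) (regPt 10) (regPt k)))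
    (.mul (.reg 23) (orientExpr (regPt 12) (regPt 14) (regPt k)))

/-- A coordinate of `bisectorDir`. -/
def dirExpr (e : ℕ) : RExpr :=
  .sub (.mul (.reg 22) (.sub (.reg (10 + e)) (.reg (8 + e))))
    (.mul (.reg 23) (.sub (.reg (14 + e)) (.reg (12 + e))))

/-- Computes the coefficients of `bisectorFun` and its values at the given points. -/
def coeffProg : RamProg :=
  .seq (.setR 22 (sqrtExpr 12)) (.seq (.setR 23 (sqrtExpr 8)) (.seq (.setR 24 (bisectorExpr 0))
    (.setR 25 (bisectorExpr 2))))

/-- Computes `hilbertMidpoint` and `bisectorDir`. -/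
def lineProg : RamProg :=
  .seq (.setR 26 (.div (.reg 24) (.sub (.reg 24) (.reg 25))))
    (.seq (.setR 16 (.add (.reg 0) (.mul (.reg 26) (.sub (.reg 2) (.reg 0)))))
      (.seq (.setR 17 (.add (.reg 1) (.mul (.reg 26) (.sub (.reg 3) (.reg 1)))))
        (.seq (.setR 18 (dirExpr 0)) (.setR 19 (dirExpr 1)))))

theorem SidesFound.frame {p q : Plane} {i j : Fin m} {s s' : RamState}
    (h : SidesFound v p q i j s) (hr : ∀ k < 16, s'.rreg k = s.rreg k) :
    SidesFound v p q i j s' := by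
  have hpt : ∀ k < 15, s'.pt k = s.pt k := fun k hk =>
    RamState.pt_congr (hr _ (by omega)) (hr _ (by omega))
  obtain ⟨h1, h2, h3, h4, h5, h6, h7, h8⟩ := h
  constructor <;> first | assumption | (rw [hpt _ (by norm_num)]; assumption)

theorem SidesFound.eval_side {p q : Plane} {i j : Fin m} {s : RamState}
    (h : SidesFound v p q i j s) (k : ℕ) :
    (orientExpr (regPt 8) (regPt 10) (regPt k)).eval s = some (sideFun v i (s.pt k)) ∧
      (orientExpr (regPt 12) (regPt 14) (regPt k)).eval s = some (sideFun v j (s.pt k)) := by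
  rw [eval_orientExpr_reg, eval_orientExpr_reg, h.i0, h.i1, h.j0, h.j1]
  exact ⟨rfl, rfl⟩

theorem SidesFound.eval_bisectorExpr {p q : Plane} {i j : Fin m} {s : RamState}
    (h : SidesFound v p q i j s) (h22 : s.rreg 22 = Real.sqrt (sideFun v j p * sideFun v j q))
    (h23 : s.rreg 23 = Real.sqrt (sideFun v i p * sideFun v i q)) (k : ℕ) :
    (bisectorExpr k).eval s = some (bisectorFun v i j p q (s.pt k)) := by
  simp [bisectorExpr, RExpr.eval, (h.eval_side k).1, (h.eval_side k).2, h22, h23, bisectorFun,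
    -eval_orientExpr_reg]

theorem coeffProg_wp {p q : Plane} {i j : Fin m} {s : RamState} (h : SidesFound v p q i j s)
    (hp : ∀ k, 0 < sideFun v k p) (hq : ∀ k, 0 < sideFun v k q) :
    coeffProg.wp (fun s' => SidesFound v p q i j s' ∧
      s'.rreg 22 = Real.sqrt (sideFun v j p * sideFun v j q) ∧
      s'.rreg 23 = Real.sqrt (sideFun v i p * sideFun v i q) ∧
      s'.rreg 24 = bisectorFun v i j p q p ∧ s'.rreg 25 = bisectorFun v i j p q q) s := by
  have hframe : ∀ {s : RamState} {k : ℕ} {x : ℝ}, 16 ≤ k → SidesFound v p q i j s →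
      SidesFound v p q i j { s with rreg := Function.update s.rreg k x } := fun hk hs =>
    hs.frame fun l hl => Function.update_of_ne (by omega) _ _
  unfold coeffProg
  simp only [RamProg.wp_seq]
  refine RamProg.wp_setR (RExpr.eval_sqrt (x := sideFun v j p * sideFun v j q) ?_
    (mul_pos (hp j) (hq j)).le) ?_
  · simp [RExpr.eval, (h.eval_side _).2, h.p0, h.q0]
  have h1 := hframe (k := 22) (x := Real.sqrt (sideFun v j p * sideFun v j q)) (by norm_num) h
  refine RamProg.wp_setR (RExpr.eval_sqrt (x := sideFun v i p * sideFun v i q) ?_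
    (mul_pos (hp i) (hq i)).le) ?_
  · simp [RExpr.eval, (h1.eval_side _).1, h1.p0, h1.q0]
  have h2 := hframe (k := 23) (x := Real.sqrt (sideFun v i p * sideFun v i q)) (by norm_num) h1
  refine RamProg.wp_setR (x := bisectorFun v i j p q p) ?_ ?_
  · rw [h2.eval_bisectorExpr (by simp) (by simp), h2.p0]
  have h3 := hframe (k := 24) (x := bisectorFun v i j p q p) (by norm_num) h2
  refine RamProg.wp_setR (x := bisectorFun v i j p q q) ?_ ?_
  · rw [h3.eval_bisectorExpr (by simp) (by simp), h3.q0]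
  have h4 := hframe (k := 25) (x := bisectorFun v i j p q q) (by norm_num) h3
  exact ⟨h4, by simp, by simp, by simp, by simp⟩

theorem lineProg_wp (hm : 3 ≤ m) (hv : IsCCWConvex v) {p q : Plane} {i j : Fin m} {s : RamState}
    (h : SidesFound v p q i j s) (hp : ∀ k, 0 < sideFun v k p) (hq : ∀ k, 0 < sideFun v k q)
    (hpq : p ≠ q) (h22 : s.rreg 22 = Real.sqrt (sideFun v j p * sideFun v j q))
    (h23 : s.rreg 23 = Real.sqrt (sideFun v i p * sideFun v i q))
    (h24 : s.rreg 24 = bisectorFun v i j p q p) (h25 : s.rreg 25 = bisectorFun v i j p q q) :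
    lineProg.wp (fun s' => SidesFound v p q i j s' ∧ s'.pt 16 = hilbertMidpoint v i j p q ∧
      s'.pt 18 = bisectorDir v i j p q) s := by
  -- The division is defined because `bisectorFun` is positive at p and negative at q.
  have hne : s.rreg 24 - s.rreg 25 ≠ 0 := by
    rw [h24, h25]
    have h1 := bisectorFun_left_pos hm hv hp hq hpq h.domi h.domj
    have h2 := bisectorFun_right_neg hm hv hp hq hpq h.domi h.domj
    linarith
  unfold lineProg
  rw [RamProg.wp_seq]
  refine RamProg.wp_setR (RExpr.eval_div (x := s.rreg 24) (y := s.rreg 24 - s.rreg 25) rfl rfl hne)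
    ?_
  simp only [RamProg.wp, RExpr.eval, dirExpr, Option.some.injEq, exists_eq_left', Option.bind_some]
  refine ⟨h.frame fun k hk => ?_, ?_, ?_⟩
  · have : k ≠ 16 ∧ k ≠ 17 ∧ k ≠ 18 ∧ k ≠ 19 ∧ k ≠ 26 := by omega
    simp [this]
  · rw [hilbertMidpoint, ← h24, ← h25, ← h.p0, ← h.q0]
    apply plane_ext <;> simp [RamState.pt]
  · rw [bisectorDir, ← h22, ← h23, ← h.i0, ← h.i1, ← h.j0, ← h.j1]
    apply plane_ext <;> simp [RamState.pt]

/-- Reverses the direction. -/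
def negDir : RamProg :=
  .seq (.setR 18 (.sub (.const 0) (.reg 18))) (.setR 19 (.sub (.const 0) (.reg 19)))

/-- Makes the direction lexicographically negative. -/
def signProg : RamProg :=
  .ite (.rlt (.const 0) (.reg 18)) negDir
    (.ite (.rlt (.reg 18) (.const 0)) .skip (.ite (.rlt (.const 0) (.reg 19)) negDir .skip))

theorem negDir_wp (s : RamState) : negDir.wp (fun s' => (∀ k < 18, s'.rreg k = s.rreg k) ∧
    s'.pt 18 = -s.pt 18) s := by
  simp only [negDir, RamProg.wp, RExpr.eval, Option.some.injEq, exists_eq_left', Option.bind_some]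
  refine ⟨fun k hk => ?_, ?_⟩
  · have : k ≠ 18 ∧ k ≠ 19 := by omega
    simp [this]
  · apply plane_ext <;> simp [RamState.pt]

theorem signProg_wp (s : RamState) (hd : s.pt 18 ≠ 0) : signProg.wp (fun s' =>
    (∀ k < 18, s'.rreg k = s.rreg k) ∧ (s'.pt 18 = s.pt 18 ∨ s'.pt 18 = -s.pt 18) ∧
      (s'.pt 18 0 < 0 ∨ s'.pt 18 0 = 0 ∧ s'.pt 18 1 < 0)) s := by
  have e0 : s.pt 18 0 = s.rreg 18 := by simp [RamState.pt]
  have e1 : s.pt 18 1 = s.rreg 19 := by simp [RamState.pt]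
  refine RamProg.wp_ite_rlt (RExpr.eval_zero _) rfl (fun h => ?_) (fun h => ?_)
  · refine RamProg.wp_mono (negDir_wp s) fun s' ⟨hr, hn⟩ => ⟨hr, Or.inr hn, Or.inl ?_⟩
    rw [hn, PiLp.neg_apply, e0]; linarith
  refine RamProg.wp_ite_rlt rfl (RExpr.eval_zero _) (fun h' => ?_) (fun h' => ?_)
  · exact ⟨fun _ _ => rfl, Or.inl rfl, Or.inl (by rw [e0]; exact h')⟩
  have h0 : s.rreg 18 = 0 := le_antisymm h h'
  refine RamProg.wp_ite_rlt (RExpr.eval_zero _) rfl (fun h' => ?_) (fun h' => ?_)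
  · refine RamProg.wp_mono (negDir_wp s) fun s' ⟨hr, hn⟩ => ⟨hr, Or.inr hn, Or.inr ⟨?_, ?_⟩⟩
    · rw [hn, PiLp.neg_apply, e0, h0, neg_zero]
    · rw [hn, PiLp.neg_apply, e1]; linarith
  · refine ⟨fun _ _ => rfl, Or.inl rfl, Or.inr ⟨by rw [e0, h0], ?_⟩⟩
    rw [e1]
    refine lt_of_le_of_ne h' fun h1 => hd (plane_ext ?_ ?_)
    · simp [e0, h0]
    · simp [e1, h1]

/-- The rate at which `orient` with respect to the points in the registers `a` and `b` decreases in
the chosen direction. -/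
def rateExpr (a b : ℕ) : RExpr :=
  .sub (.mul (.sub (.reg (b + 1)) (.reg (a + 1))) (.reg 18))
    (.mul (.sub (.reg b) (.reg a)) (.reg 19))

/-- Takes one constraint into account: the admissible steps are those up to the quotient of the
real registers `30` and `31`. -/
def constraintStep (a b : ℕ) : RamProg :=
  .ite (.rlt (.const 0) (rateExpr a b))
    (.ite (.rlt (.mul (orientExpr (regPt a) (regPt b) (regPt 16)) (.reg 31))
        (.mul (.reg 30) (rateExpr a b)))
      (.seq (.setR 30 (orientExpr (regPt a) (regPt b) (regPt 16))) (.setR 31 (rateExpr a b))) .skip)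
    .skip

/-- Takes a list of constraints into account. -/
def constraintLoop : List (ℕ × ℕ) → RamProg
  | [] => .skip
  | ab :: L => .seq (constraintStep ab.1 ab.2) (constraintLoop L)

/-- The admissible steps with respect to a list of constraints are described by the real registers
`30` and `31`. -/
structure RatioInv (s₀ : RamState) (L : List (ℕ × ℕ)) (s : RamState) : Prop where
  rreg : ∀ k < 30, s.rreg k = s₀.rreg k
  num : 0 ≤ s.rreg 30
  den : 0 ≤ s.rreg 31
  num_pos : s.rreg 31 = 0 → 0 < s.rreg 30
  iff : ∀ t : ℝ, 0 ≤ t → (t * s.rreg 31 ≤ s.rreg 30 ↔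
    ∀ ab ∈ L, 0 ≤ orient (s₀.pt ab.1) (s₀.pt ab.2) (s₀.pt 16 + t • s₀.pt 18))

/-- `rateExpr` in terms of the points. -/
def rate (a b d : Plane) : ℝ := (b 1 - a 1) * d 0 - (b 0 - a 0) * d 1

theorem orient_add_smul_eq_sub_rate (a b x d : Plane) (t : ℝ) :
    orient a b (x + t • d) = orient a b x - t * rate a b d := by
  rw [orient_add_smul, rate]; ring

theorem eval_rateExpr (s : RamState) (a b : ℕ) :
    (rateExpr a b).eval s = some (rate (s.pt a) (s.pt b) (s.pt 18)) := by
  simp [rateExpr, RExpr.eval, rate, RamState.pt]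

/-- A constraint with nonpositive rate holds for all nonnegative steps, as it holds at the start.
One with positive rate bounds the step by a quotient, which is compared with the stored one by
cross-multiplication. -/
theorem constraintStep_wp {s₀ s : RamState} {L : List (ℕ × ℕ)} {a b : ℕ} (h : RatioInv s₀ L s)
    (ha : a < 29) (hb : b < 29) (h0 : 0 ≤ orient (s₀.pt a) (s₀.pt b) (s₀.pt 16)) :
    (constraintStep a b).wp (RatioInv s₀ (L ++ [(a, b)])) s := by
  have hpt : ∀ {s : RamState}, (∀ k < 30, s.rreg k = s₀.rreg k) → ∀ k < 29, s.pt k = s₀.pt k :=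
    fun hr k hk => RamState.pt_congr (hr _ (by omega)) (hr _ (by omega))
  have hrate := eval_rateExpr s a b
  have horient := eval_orientExpr_reg s a b 16
  rw [hpt h.rreg a ha, hpt h.rreg b hb, hpt h.rreg 18 (by norm_num)] at hrate
  rw [hpt h.rreg a ha, hpt h.rreg b hb, hpt h.rreg 16 (by norm_num)] at horient
  have hmem : ∀ t : ℝ, (∀ ab ∈ L ++ [(a, b)],
      0 ≤ orient (s₀.pt ab.1) (s₀.pt ab.2) (s₀.pt 16 + t • s₀.pt 18)) ↔
      (∀ ab ∈ L, 0 ≤ orient (s₀.pt ab.1) (s₀.pt ab.2) (s₀.pt 16 + t • s₀.pt 18)) ∧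
        t * rate (s₀.pt a) (s₀.pt b) (s₀.pt 18) ≤ orient (s₀.pt a) (s₀.pt b) (s₀.pt 16) := by
    intro t
    simp only [List.forall_mem_append, List.forall_mem_singleton]
    rw [orient_add_smul_eq_sub_rate (s₀.pt a), sub_nonneg]
  refine RamProg.wp_ite_rlt (RExpr.eval_zero _) hrate (fun hpos => ?_) (fun hneg => ?_)
  swap
  · refine ⟨h.rreg, h.num, h.den, h.num_pos, fun t ht => ?_⟩
    rw [hmem, h.iff t ht, iff_self_and]
    intro _
    exact (mul_nonpos_of_nonneg_of_nonpos ht hneg).trans h0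
  refine RamProg.wp_ite_rlt (x := orient (s₀.pt a) (s₀.pt b) (s₀.pt 16) * s.rreg 31)
    (y := s.rreg 30 * rate (s₀.pt a) (s₀.pt b) (s₀.pt 18))
    (by simp [RExpr.eval, horient]) (by simp [RExpr.eval, hrate]) (fun hlt => ?_) (fun hle => ?_)
  · rw [RamProg.wp_seq]
    refine RamProg.wp_setR horient (RamProg.wp_setR (x := rate (s₀.pt a) (s₀.pt b) (s₀.pt 18)) ?_ ?_)
    · rw [← hrate, eval_rateExpr, eval_rateExpr]
      congr 2 <;> refine RamState.pt_congr ?_ ?_ <;> refine Function.update_of_ne ?_ _ _ <;> omega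
    refine ⟨fun k hk => ?_, ?_, ?_, ?_, fun t ht => ?_⟩
    · have : k ≠ 30 ∧ k ≠ 31 := by omega
      simpa [this] using h.rreg k hk
    · simpa using h0
    · simpa using hpos.le
    · simp [hpos.ne']
    · rw [hmem, ← h.iff t ht]
      simp only [Function.update_self, ne_eq, Nat.reduceEqDiff, not_false_eq_true,
        Function.update_of_ne]
      refine ⟨fun ht' => ⟨?_, ht'⟩, fun ht' => ht'.2⟩
      have := mul_le_mul_of_nonneg_right ht' h.den
      refine le_of_mul_le_mul_right (a := rate (s₀.pt a) (s₀.pt b) (s₀.pt 18)) ?_ hpos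
      linarith
  · refine ⟨h.rreg, h.num, h.den, h.num_pos, fun t ht => ?_⟩
    rw [hmem, ← h.iff t ht, iff_self_and]
    intro ht'
    -- With a zero denominator, positivity of the stored numerator rules out this branch: the first
    -- constraint with positive rate always replaces the infinite bound.
    rcases h.den.eq_or_lt with hd | hd
    · have := mul_pos (h.num_pos hd.symm) hpos
      rw [← hd, mul_zero] at hle
      linarith
    · refine le_of_mul_le_mul_right (a := s.rreg 31) ?_ hd
      have := mul_le_mul_of_nonneg_right ht' hpos.le
      linarith

theorem constraintLoop_wp {s₀ s : RamState} {L' : List (ℕ × ℕ)} (L : List (ℕ × ℕ))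
    (h : RatioInv s₀ L' s) (hL : ∀ ab ∈ L, ab.1 < 29 ∧ ab.2 < 29 ∧
      0 ≤ orient (s₀.pt ab.1) (s₀.pt ab.2) (s₀.pt 16)) :
    (constraintLoop L).wp (RatioInv s₀ (L' ++ L)) s := by
  induction L generalizing L' s with
  | nil => simpa [constraintLoop, RamProg.wp] using h
  | cons ab L ih =>
    rw [List.forall_mem_cons] at hL
    rw [constraintLoop, RamProg.wp_seq]
    refine RamProg.wp_mono (constraintStep_wp h hL.1.1 hL.1.2.1 hL.1.2.2) fun s' h' => ?_
    have := ih h' hL.2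
    rwa [List.append_assoc, List.singleton_append] at this

/-- Computes the largest admissible step. -/
def stepProg : RamProg :=
  .seq (.setR 30 (.const 1)) (.seq (.setR 31 (.const 0))
    (constraintLoop (centerConstraints 0 2 8 10 12 14)))

theorem stepProg_wp {s : RamState} (h : ∀ ab ∈ centerConstraints (s.pt 0) (s.pt 2) (s.pt 8)
    (s.pt 10) (s.pt 12) (s.pt 14), 0 ≤ orient ab.1 ab.2 (s.pt 16)) :
    stepProg.wp (RatioInv s (centerConstraints 0 2 8 10 12 14)) s := by
  -- The quotient 1 / 0 stands for an infinite bound, since t * 0 ≤ 1 always holds.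
  have hinit : RatioInv s [] { s with
      rreg := Function.update (Function.update s.rreg 30 1) 31 0 } := by
    refine ⟨fun k hk => ?_, ?_, ?_, ?_, ?_⟩
    · have : k ≠ 30 ∧ k ≠ 31 := by omega
      simp [this]
    all_goals simp
  have := constraintLoop_wp (centerConstraints 0 2 8 10 12 14) hinit (by
    simp only [centerConstraints, List.forall_mem_cons, List.not_mem_nil, false_imp_iff,
      implies_true, and_true] at h ⊢
    norm_num
    exact h)
  rw [List.nil_append] at this
  simpa [stepProg, RamProg.wp, RExpr.eval] using this

/-- Writes the output. -/
def outputProg : RamProg :=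
  .seq (.setR 27 (.div (.reg 30) (.reg 31)))
    (.seq (.setR 0 (.add (.reg 16) (.mul (.reg 27) (.reg 18))))
      (.setR 1 (.add (.reg 17) (.mul (.reg 27) (.reg 19)))))

theorem outputProg_wp {s : RamState} (h : s.rreg 31 ≠ 0) : outputProg.wp (fun s' =>
    ramOutput s' = s.pt 16 + (s.rreg 30 / s.rreg 31) • s.pt 18) s := by
  unfold outputProg
  rw [RamProg.wp_seq]
  refine RamProg.wp_setR (RExpr.eval_div (x := s.rreg 30) (y := s.rreg 31) rfl rfl h) ?_
  simp only [RamProg.wp, RExpr.eval, Option.some.injEq, exists_eq_left', Option.bind_some]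
  apply plane_ext <;> simp [RamState.pt, ramOutput]

/-- Computes the lexicographically smallest center from the sides found. -/
def finalProg : RamProg :=
  .seq coeffProg (.seq lineProg (.seq signProg (.seq stepProg outputProg)))

theorem finalProg_wp (hm : 3 ≤ m) (hv : IsCCWConvex v) {p q : Plane} {i j : Fin m} {s : RamState}
    (h : SidesFound v p q i j s) (hp : ∀ k, 0 < sideFun v k p) (hq : ∀ k, 0 < sideFun v k q)
    (hpq : p ≠ q) :
    finalProg.wp (fun s' => IsLexLeast {c | IsCenter v i j p q c} (ramOutput s')) s := by
  have hc := isCenter_hilbertMidpoint hm hv hp hq hpq h.domi h.domj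
  have hd := bisectorDir_ne_zero hm hv hp hq hpq h.domi h.domj
  rw [finalProg, RamProg.wp_seq]
  refine RamProg.wp_mono (coeffProg_wp h hp hq) fun s1 ⟨h1, e22, e23, e24, e25⟩ => ?_
  rw [RamProg.wp_seq]
  refine RamProg.wp_mono (lineProg_wp hm hv h1 hp hq hpq e22 e23 e24 e25)
    fun s2 ⟨h2, e16, e18⟩ => ?_
  rw [RamProg.wp_seq]
  refine RamProg.wp_mono (signProg_wp s2 (by rwa [e18])) fun s3 ⟨hr, hs, hlex⟩ => ?_
  have h3 := h2.frame fun k hk => hr k (by omega)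
  have e16' : s3.pt 16 = hilbertMidpoint v i j p q := by
    rw [← e16]; exact RamState.pt_congr (hr _ (by norm_num)) (hr _ (by norm_num))
  rw [e18] at hs
  rw [RamProg.wp_seq]
  have hcons := ((isCenter_iff hm hv).1 hc).2
  refine RamProg.wp_mono (stepProg_wp (by
    rw [h3.p0, h3.q0, h3.i0, h3.i1, h3.j0, h3.j1, e16']; exact hcons)) fun s4 h4 => ?_
  obtain ⟨hden, hleast⟩ := isLexLeast_of_ratio hm hv hp hq hc hd hs hlex h4.num h4.den (by
    intro t ht
    rw [h4.iff t ht, e16', ← h3.p0, ← h3.q0, ← h3.i0, ← h3.i1, ← h3.j0, ← h3.j1]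
    simp only [centerConstraints, List.forall_mem_cons, List.not_mem_nil, false_imp_iff,
      implies_true, and_true])
  refine RamProg.wp_mono (outputProg_wp hden) fun s5 h5 => ?_
  have hpt : ∀ k < 29, s4.pt k = s3.pt k := fun k hk =>
    RamState.pt_congr (h4.rreg _ (by omega)) (h4.rreg _ (by omega))
  rw [h5, hpt 16 (by norm_num), hpt 18 (by norm_num), e16']
  exact hleast

end Final

/-! ### The main theorem -/

/-- The squared distance of the given points. -/
def distSqExpr : RExpr :=
  .add (.mul (.sub (.reg 0) (.reg 2)) (.sub (.reg 0) (.reg 2)))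
    (.mul (.sub (.reg 1) (.reg 3)) (.sub (.reg 1) (.reg 3)))

/-- The program for distinct points. -/
def centerProgOfNe : RamProg := .seq initProg (.seq searchProg finalProg)

/-- Computes the lexicographically smallest center of a minimum radius enclosing ball. -/
def centerProg : RamProg := .ite (.rle distSqExpr (.const 0)) .skip centerProgOfNe

/-- The cost of `centerProg` outside of its loops. -/
def centerCost : ℕ :=
  (RamTest.rle distSqExpr (.const 0)).cost + initProg.maxCost + searchCost + finalProg.maxCost + 1

theorem ramOutput_ramInput {m : ℕ} (v : Fin m → Plane) (p q : Plane) :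
    ramOutput (ramInput v p q) = p := by
  apply plane_ext <;> simp [ramOutput, ramInput]

theorem eval_distSqExpr {m : ℕ} (v : Fin m → Plane) (p q : Plane) :
    distSqExpr.eval (ramInput v p q) =
      some ((p 0 - q 0) * (p 0 - q 0) + (p 1 - q 1) * (p 1 - q 1)) := by
  simp [distSqExpr, RExpr.eval, ramInput]

theorem distSq_nonpos_iff (p q : Plane) :
    (p 0 - q 0) * (p 0 - q 0) + (p 1 - q 1) * (p 1 - q 1) ≤ 0 ↔ p = q := by
  constructor
  · intro h
    apply plane_ext
    · nlinarith [mul_self_nonneg (p 0 - q 0), mul_self_nonneg (p 1 - q 1)]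
    · nlinarith [mul_self_nonneg (p 0 - q 0), mul_self_nonneg (p 1 - q 1)]
  · rintro rfl; simp

theorem centerProgOfNe_run {m n : ℕ} {v : Fin m → Plane} (hm : 3 ≤ m) (hv : IsCCWConvex v)
    {p q : Plane} (hp : ∀ k, 0 < sideFun v k p) (hq : ∀ k, 0 < sideFun v k q) (hpq : p ≠ q)
    (hn : m ≤ 2 ^ n) :
    centerProgOfNe.Run (ramInput v p q) (initProg.maxCost +
      (searchCost + 3 * bisectCost * (n + 1) + finalProg.maxCost))
      fun s' => IsLexLeast (minBallCenters (polygon v) {p, q}) (ramOutput s') := by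
  refine (initProg_wp hm p q).run.seq fun s1 ⟨p', q', hpq', hr, hs0, h0⟩ => ?_
  have hcase : (∀ k, 0 < sideFun v k p') ∧ (∀ k, 0 < sideFun v k q') ∧ p' ≠ q' ∧
      ({p', q'} : Set Plane) = {p, q} := by
    rcases hpq' with ⟨rfl, rfl⟩ | ⟨rfl, rfl⟩
    · exact ⟨hp, hq, hpq, rfl⟩
    · exact ⟨hq, hp, hpq.symm, Set.pair_comm _ _⟩
  obtain ⟨hp', hq', hne, hset⟩ := hcase
  refine (searchProg_run hm hv hp' hr hs0 h0 hn).seq fun s2 ⟨i, j, h2⟩ => ?_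
  refine (finalProg_wp hm hv h2 hp' hq' hne).run.mono le_rfl fun s3 h3 => ?_
  rw [← hset, minBallCenters_eq hm hv hp' hq' hne h2.domi h2.domj]
  exact h3

theorem one_le_log_of_three_le {m : ℕ} (hm : 3 ≤ m) : 1 ≤ Real.log m := by
  have h3 : (3 : ℝ) ≤ m := by exact_mod_cast hm
  rw [Real.le_log_iff_exp_le (by linarith)]
  linarith [Real.exp_one_lt_d9]

/-- The factor 2 suffices because log 2 > 1/2. -/
theorem natLog_le_two_mul_log {m : ℕ} (hm : 3 ≤ m) : (Nat.log 2 m : ℝ) ≤ 2 * Real.log m := by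
  have h1 : (Nat.log 2 m : ℝ) ≤ Real.logb 2 m := by exact_mod_cast Real.natLog_le_logb m 2
  refine h1.trans ?_
  have h2 := one_le_log_of_three_le hm
  have h3 := Real.log_two_gt_d9
  rw [Real.logb, div_le_iff₀ (by linarith)]
  nlinarith

theorem mainTheorem12 :
    ∃ (P : RamProg) (C : ℝ), ∀ (m : ℕ) (v : Fin m → Plane), 3 ≤ m → IsCCWConvex v →
      ∀ p q : Plane, p ∈ interior (polygon v) → q ∈ interior (polygon v) →
        (∃ (s : RamState) (t : ℕ), RamExec P (ramInput v p q) s t ∧ (t : ℝ) ≤ C * Real.log m ∧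
          IsLexLeast (minBallCenters (polygon v) {p, q}) (ramOutput s) ∧
          (p ≠ q → IsLexLeast (bisector (polygon v) p q ∩ sectorBetween v p q) (ramOutput s))) ∧
        (p ≠ q →
          minBallCenters (polygon v) {p, q} = bisector (polygon v) p q ∩ sectorBetween v p q ∧
          ∃ a b : Plane, bisector (polygon v) p q ∩ sectorBetween v p q = segment ℝ a b) := by
  -- Three bisections, each bounded by log₂ m + 2 ≤ 4 log m rounds, account for the factor 12;
  -- absorbing the constants uses log m ≥ 1.
  refine ⟨centerProg, centerCost + 12 * bisectCost, fun m v hm hv p q hpi hqi => ?_⟩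
  have hp := (mem_interior_polygon_iff hm hv).1 hpi
  have hq := (mem_interior_polygon_iff hm hv).1 hqi
  have hset : p ≠ q → ∃ i j, Dominates v i p q ∧ Dominates v j q p := fun _ => by
    obtain ⟨i, hi⟩ := exists_dominates hm p hq
    obtain ⟨j, hj⟩ := exists_dominates hm q hp
    exact ⟨i, j, hi, hj⟩
  have heq : p ≠ q →
      minBallCenters (polygon v) {p, q} = bisector (polygon v) p q ∩ sectorBetween v p q :=
    fun hpq => by
      obtain ⟨i, j, hi, hj⟩ := hset hpq
      rw [minBallCenters_eq hm hv hp hq hpq hi hj,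
        bisector_inter_sectorBetween_eq hm hv hp hq hpq hi hj]
  refine ⟨?_, fun hpq => ⟨heq hpq, ?_⟩⟩
  · have hrun : centerProg.Run (ramInput v p q)
        (centerCost + 3 * bisectCost * (Nat.log 2 m + 2))
        fun s' => IsLexLeast (minBallCenters (polygon v) {p, q}) (ramOutput s') := by
      by_cases hpq : p = q
      -- For p = q the only center is p, whose coordinates are already in the output registers.
      · refine ⟨_, _, .iteTrue _ _ _ _ _ _ ?_ (.skip _), ?_, ?_⟩
        · simp [RamTest.eval, eval_distSqExpr, RExpr.eval_zero, hpq]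
        · unfold centerCost; omega
        · beta_reduce
          rw [ramOutput_ramInput, ← hpq, minBallCenters_self hm hv hp]
          refine ⟨rfl, fun x hx => Or.inr ?_⟩
          rw [Set.mem_singleton_iff.1 hx]
          exact ⟨rfl, le_rfl⟩
      · obtain ⟨s, t, he, ht, hs⟩ := centerProgOfNe_run hm hv hp hq hpq
          (Nat.lt_pow_succ_log_self one_lt_two m).le
        refine ⟨s, _, .iteFalse _ _ _ _ _ _ ?_ he, ?_, hs⟩
        · simp [RamTest.eval, eval_distSqExpr, RExpr.eval_zero, distSq_nonpos_iff, hpq]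
        · unfold centerCost; linarith
    obtain ⟨s, t, he, ht, hs⟩ := hrun
    refine ⟨s, t, he, ?_, hs, fun hpq => heq hpq ▸ hs⟩
    have h1 := one_le_log_of_three_le hm
    have h2 := natLog_le_two_mul_log hm
    calc (t : ℝ) ≤ centerCost + 3 * bisectCost * (Nat.log 2 m + 2) := by exact_mod_cast ht
      _ ≤ centerCost * Real.log m + 3 * bisectCost * (2 * Real.log m + 2 * Real.log m) := by
        gcongr
        · exact le_mul_of_one_le_right (Nat.cast_nonneg _) h1
        · linarith
      _ = (centerCost + 12 * bisectCost) * Real.log m := by ring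
  · obtain ⟨i, j, hi, hj⟩ := hset hpq
    rw [bisector_inter_sectorBetween_eq hm hv hp hq hpq hi hj]
    exact exists_isCenter_eq_segment hm hv hp hq hpq hi hj
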